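/- Let $r\ge 2$ and $\tau>0$. Data are vectors $v\in\mathbb{R}_{\ge 0}^r$, and for $p>0$ let $\mathrm{RG}_p(v)=(\max_i v_i-\min_i v_i)^p$. In shared-seed (coordinated) PPS sampling with all thresholds equal to $\tau$, a scalar seed $u\in(0,1]$ is drawn uniformly at random, and the outcome $S=S(u,v)$ consists of $u$ and of the values $v_i$ of the sampled entries, where entry $i$ is sampled if and only if $v_i\ge\tau u$. Let $S^*$ be the set of vectors $z\in\mathbb{R}_{\ge 0}^r$ consistent with $S$ (that is, $z_i=v_i$ for sampled $i$ and $z_i<\tau u$ for the other $i$), and let $\underline{\mathrm{RG}}_p(u,v)=\inf_{z\in S^*(u,v)}\mathrm{RG}_p(z)$. The L estimator of $\mathrm{RG}_p$ is the function of the outcome given by $$\widehat{\mathrm{RG}}_p^{(L)}(S(\zeta,v))=\frac{\underline{\mathrm{RG}}_p(\zeta,v)}{\zeta}-\int_\zeta^1\frac{\underline{\mathrm{RG}}_p(u,v)}{u^2}\,du .$$ An estimator of $\mathrm{RG}_p$ is called $v$-optimal if, among all estimators (functions of the outcome) that are nonnegative on all possible outcomes and unbiased for all data, it has the minimum possible variance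 when the data is $v$. Then for every data vector $v$ and each $p\in\{1,2\}$ a $v$-optimal estimator $\widehat{\mathrm{RG}}_p^{(v)}$ exists, and every such estimator satisfies $$\mathbb{E}\big[\widehat{\mathrm{RG}}_1^{(L)}(S)^2\big]\le 2\,\mathbb{E}\big[\widehat{\mathrm{RG}}_1^{(v)}(S)^2\big],\qquad \mathbb{E}\big[\widehat{\mathrm{RG}}_2^{(L)}(S)^2\big]\le \tfrac52\,\mathbb{E}\big[\widehat{\mathrm{RG}}_2^{(v)}(S)^2\big],$$ where $S=S(u,v)$ with $u$ uniform on $(0,1]$. Both ratios are tight: for each of the two inequalities there is a data vector $v$ for which equality holds, with $0<\mathbb{E}\big[\widehat{\mathrm{RG}}_p^{(v)}(S)^2\big]<\infty$. -/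

import Mathlib

open MeasureTheory ProbabilityTheory Set
open scoped ENNReal

noncomputable section

namespace SharedSeed

variable {r : ℕ}

/-- The exponentiated range `(max v - min v) ^ p` of a data vector. -/
def expRange (p : ℝ) (v : Fin r → ℝ) : ℝ := ((⨆ i, v i) - ⨅ i, v i) ^ p

/-- An outcome of shared-seed sampling: the scalar seed, and for each entry either its exact value
(the entry is sampled) or nothing (the entry is not sampled). The thresholds are fixed and known. -/
@[ext] structure Outcome (r : ℕ) where
  seed : ℝ
  entry : Fin r → Option ℝ

/-- The outcome `S(u, v)`: entry `i` is sampled if and only if `v i ≥ τ i * u`. -/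
def outcome (τ : Fin r → ℝ) (u : ℝ) (v : Fin r → ℝ) : Outcome r where
  seed := u
  entry i := if τ i * u ≤ v i then some (v i) else none

/-- The set `S^*` of all (nonnegative) data vectors consistent with the outcome `S`. -/
def consistent (τ : Fin r → ℝ) (S : Outcome r) : Set (Fin r → ℝ) :=
  {z | 0 ≤ z ∧ ∀ i, (∀ x, S.entry i = some x → z i = x) ∧
    (S.entry i = none → z i < τ i * S.seed)}

/-- The lower bound function: the infimum of `expRange p` over the vectors consistent with `S`. -/
def lowerBound (τ : Fin r → ℝ) (p : ℝ) (S : Outcome r) : ℝ := sInf (expRange p '' consistent τ S)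

/-- The less informative outcome that the same data yields with a larger seed `u`; it is a function
of the outcome alone (see `coarsen_outcome`). -/
def Outcome.coarsen (τ : Fin r → ℝ) (S : Outcome r) (u : ℝ) : Outcome r where
  seed := u
  entry i := (S.entry i).filter fun x => decide (τ i * u ≤ x)

theorem coarsen_outcome (τ : Fin r → ℝ) (hτ : 0 ≤ τ) {ζ u : ℝ} (h : ζ ≤ u) (v : Fin r → ℝ) :
    (outcome τ ζ v).coarsen τ u = outcome τ u v := by
  ext i x
  · rfl
  · have h1 : τ i * ζ ≤ τ i * u := mul_le_mul_of_nonneg_left h (hτ i)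
    by_cases h2 : τ i * u ≤ v i
    · simp only [Outcome.coarsen, outcome, h2, h1.trans h2, if_true, Option.filter_some,
        decide_true]
    · by_cases h3 : τ i * ζ ≤ v i <;>
        simp only [Outcome.coarsen, outcome, h2, h3, if_true, if_false, Option.filter_some,
          Option.filter_none, decide_false, Bool.false_eq_true]

/-- The L estimator, as a function of the outcome. -/
def LEstimator (τ : Fin r → ℝ) (p : ℝ) (S : Outcome r) : ℝ :=
  lowerBound τ p S / S.seed - ∫ u in S.seed..1, lowerBound τ p (S.coarsen τ u) / u ^ 2

/-- On the outcome `S(ζ, v)` the L estimator is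
`lb(ζ, v) / ζ - ∫ u in ζ..1, lb(u, v) / u ^ 2`, where `lb(u, v)` is the lower bound on `S(u, v)`. -/
theorem LEstimator_outcome (τ : Fin r → ℝ) (hτ : 0 ≤ τ) (p : ℝ) {ζ : ℝ} (h1 : ζ ≤ 1)
    (v : Fin r → ℝ) :
    LEstimator τ p (outcome τ ζ v) = lowerBound τ p (outcome τ ζ v) / ζ -
      ∫ u in ζ..1, lowerBound τ p (outcome τ u v) / u ^ 2 := by
  unfold LEstimator
  congr 1
  refine intervalIntegral.integral_congr fun u hu => ?_
  have hu' : u ∈ Icc ζ 1 := by rwa [← uIcc_of_le h1]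
  simp only [coarsen_outcome τ hτ hu'.1 v]

/-- The uniform distribution of the seed on `(0, 1]`. -/
def seedMeasure : Measure ℝ := volume.restrict (Ioc 0 1)

/-- `g` is an estimator of `expRange p` that is nonnegative on all possible outcomes and unbiased
for all data. -/
structure IsNonnegUnbiased (τ : Fin r → ℝ) (p : ℝ) (g : Outcome r → ℝ) : Prop where
  nonneg : ∀ u ∈ Ioc (0 : ℝ) 1, ∀ v : Fin r → ℝ, 0 ≤ v → 0 ≤ g (outcome τ u v)
  integrable : ∀ v : Fin r → ℝ, 0 ≤ v → Integrable (fun u => g (outcome τ u v)) seedMeasure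
  unbiased : ∀ v : Fin r → ℝ, 0 ≤ v → ∫ u, g (outcome τ u v) ∂seedMeasure = expRange p v

/-- The variance (possibly infinite) of the estimator `g` on data `v`. -/
def estVariance (τ : Fin r → ℝ) (g : Outcome r → ℝ) (v : Fin r → ℝ) : ℝ≥0∞ :=
  evariance (fun u => g (outcome τ u v)) seedMeasure

/-- The expectation (possibly infinite) of the square of the estimator `g` on data `v`. -/
def secondMoment (τ : Fin r → ℝ) (g : Outcome r → ℝ) (v : Fin r → ℝ) : ℝ≥0∞ :=
  ∫⁻ u, ENNReal.ofReal (g (outcome τ u v) ^ 2) ∂seedMeasure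

/-- `g` is `v`-optimal: among all estimators of `expRange p` that are nonnegative and unbiased for
all data, it has the minimum possible variance when the data is `v`. -/
def IsVOptimal (τ : Fin r → ℝ) (p : ℝ) (v : Fin r → ℝ) (g : Outcome r → ℝ) : Prop :=
  IsNonnegUnbiased τ p g ∧
    ∀ g' : Outcome r → ℝ, IsNonnegUnbiased τ p g' → estVariance τ g v ≤ estVariance τ g' v

/-- The L estimator of `expRange p` is variance-competitive with tight ratio `c`: for all data `v`,
a `v`-optimal estimator exists, and the second moment of the L estimator on `v` is at most `c` times
that of any `v`-optimal estimator, with equality (between positive finite numbers) for some `v`. -/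
def LHasTightRatio (τ : Fin r → ℝ) (p : ℝ) (c : ℝ≥0∞) : Prop :=
  (∀ v : Fin r → ℝ, 0 ≤ v →
    (∃ g, IsVOptimal τ p v g) ∧
    ∀ g, IsVOptimal τ p v g → secondMoment τ (LEstimator τ p) v ≤ c * secondMoment τ g v) ∧
  ∃ v : Fin r → ℝ, 0 ≤ v ∧ ∃ g, IsVOptimal τ p v g ∧
    0 < secondMoment τ g v ∧ secondMoment τ g v < ∞ ∧
    secondMoment τ (LEstimator τ p) v = c * secondMoment τ g v

end SharedSeed

end

/-!
Along one data vector `v` the lower bound function `B` is continuous and antitone with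
`B 0 = expRange p v`. A function `h` of the seed extends to a nonnegative unbiased estimator that
equals `h` on the outcomes of `v` if and only if `h ≥ 0`, `∫ h = B 0`, and `∫ u in x..1, h u ≤ B x`
for all `x`. Necessity (`IsNonnegUnbiased.isFeasiblePath`) holds because the estimator also has to be
unbiased for all data consistent with the outcome at `x`. For sufficiency
(`isNonnegUnbiased_extendPath`), data `z` that separate from `v` at the seed `ρ` get what `h` has left
of their lower bound at `ρ`, spread evenly over `(0, ρ]`, plus the increase of the L estimator since
`ρ`; this increase is nonnegative, and its integral is the increase of the lower bound
(`integral_lPath`).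

So a `v`-optimal estimator is found by minimizing `∫ h ^ 2` over the feasible `h`. The minimizer is
the slope, with the opposite sign, of the greatest convex minorant of `B` with the value at `1`
lowered to `0`. In units of the threshold, with `a` and `b` the maximum and the minimum of the data,
`B u = max 0 (a - max b u) ^ p`. For `p = 1` the minorant is a chord followed by `0`. For `p = 2` it
is a chord, or the curve `(a - u) ^ 2` with affine pieces at its ends (`IsMinorantCurve`).

On `(b, min a 1)` the L estimator is a primitive of `B' u / u`, and it is constant below `b`, so its
second moment has a closed form (`IsLProfile.sq_lPath`). For `p = 1` the claim is then
`log x ≤ x - 1`. For `p = 2` and `a ≥ 1` (smaller `a` follow by scaling from `a = 1`), `5 / 2` times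
the second moment of the minimizer minus that of the L estimator has derivative `-4 (a - b) k` in `b`,
where `k` is `5 / 2` times the initial slope of the minorant minus the initial value of the L
estimator. As `k` changes sign at most once, from negative to positive, the difference is least at
`b = 0` or `b = 1`, where it is a nonnegative polynomial in `a` (`lMoment_le`). Equality holds for
`a = 1`, `b = 0` in both cases.
-/

noncomputable section

namespace SharedSeed

open Filter Topology

/-! ### Sampling with equal thresholds -/

section Sampling

variable {r : ℕ} {τ : ℝ}

/-- The closed form of the lower bound function of data `v` when all thresholds equal `τ`. It is
defined for every real seed, and its value at `0` is `expRange p v`. -/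
def lowerPath (τ p : ℝ) (v : Fin r → ℝ) (u : ℝ) : ℝ :=
  (max 0 ((⨆ i, v i) - max (⨅ i, v i) (τ * u))) ^ p

theorem outcome_eq_iff {u : ℝ} {z v : Fin r → ℝ} :
    outcome (fun _ => τ) u z = outcome (fun _ => τ) u v ↔
      ∀ i, z i ≠ v i → z i < τ * u ∧ v i < τ * u := by
  rw [Outcome.ext_iff]
  simp only [outcome, funext_iff, true_and]
  refine forall_congr' fun i => ?_
  by_cases h1 : τ * u ≤ z i <;> by_cases h2 : τ * u ≤ v i
  · simp only [h1, h2, if_true, Option.some.injEq]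
    constructor
    · intro h hn; exact absurd h hn
    · intro h; by_contra hn; exact absurd (h hn).1 (not_lt.2 h1)
  · simp only [h1, h2, if_true, if_false, reduceCtorEq, false_iff]
    intro h
    have hn : z i ≠ v i := fun e => h2 (e ▸ h1)
    exact absurd (h hn).1 (not_lt.2 h1)
  · simp only [h1, h2, if_true, if_false, reduceCtorEq, false_iff]
    intro h
    have hn : z i ≠ v i := fun e => h1 (e ▸ h2)
    exact absurd (h hn).2 (not_lt.2 h2)
  · simp only [h1, h2, if_false, true_iff]
    intro _
    exact ⟨not_le.1 h1, not_le.1 h2⟩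

theorem outcome_eq_of_le (hτ : 0 < τ) {x u : ℝ} (hxu : x ≤ u) {z v : Fin r → ℝ}
    (h : outcome (fun _ => τ) x z = outcome (fun _ => τ) x v) :
    outcome (fun _ => τ) u z = outcome (fun _ => τ) u v := by
  rw [outcome_eq_iff] at h ⊢
  intro i hi
  have := mul_le_mul_of_nonneg_left hxu hτ.le
  exact ⟨(h i hi).1.trans_le this, (h i hi).2.trans_le this⟩

theorem mem_consistent_outcome_iff {u : ℝ} {z v : Fin r → ℝ} :
    z ∈ consistent (fun _ => τ) (outcome (fun _ => τ) u v) ↔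
      0 ≤ z ∧ outcome (fun _ => τ) u z = outcome (fun _ => τ) u v := by
  rw [outcome_eq_iff]
  simp only [consistent, outcome, mem_ofPred_eq]
  refine and_congr_right fun _ => forall_congr' fun i => ?_
  by_cases h2 : τ * u ≤ v i
  · simp only [h2, if_true, Option.some.injEq, forall_eq', reduceCtorEq, false_imp_iff, and_true,
      not_lt.2 h2, and_false]
    tauto
  · simp only [h2, if_false, reduceCtorEq, false_imp_iff, implies_true, true_and, true_imp_iff,
      not_le.1 h2, and_true]
    refine ⟨fun h _ => h, fun h => ?_⟩
    by_cases e : z i = v i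
    · rw [e]; exact not_le.1 h2
    · exact h e

theorem antitone_lowerPath (hτ : 0 < τ) {p : ℝ} (hp : 0 < p) (v : Fin r → ℝ) :
    Antitone (lowerPath τ p v) := by
  intro x y hxy
  refine Real.rpow_le_rpow (le_max_left _ _) ?_ hp.le
  have := mul_le_mul_of_nonneg_left hxy hτ.le
  gcongr

theorem continuous_lowerPath {p : ℝ} (hp : 0 < p) (v : Fin r → ℝ) :
    Continuous (lowerPath τ p v) := by
  unfold lowerPath
  exact Continuous.rpow_const (by fun_prop) fun _ => Or.inr hp.le

theorem lowerPath_nonneg {p : ℝ} (v : Fin r → ℝ) (u : ℝ) : 0 ≤ lowerPath τ p v u :=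
  Real.rpow_nonneg (le_max_left _ _) _

theorem iInf_le_apply (v : Fin r → ℝ) (i : Fin r) : ⨅ i, v i ≤ v i :=
  ciInf_le (finite_range v).bddBelow i

theorem apply_le_iSup (v : Fin r → ℝ) (i : Fin r) : v i ≤ ⨆ i, v i :=
  le_ciSup (finite_range v).bddAbove i

theorem lowerPath_zero [NeZero r] {p : ℝ} {v : Fin r → ℝ} (hv : 0 ≤ v) :
    lowerPath τ p v 0 = expRange p v := by
  have h1 : 0 ≤ ⨅ i, v i := le_ciInf hv
  have h2 : ⨅ i, v i ≤ ⨆ i, v i := (iInf_le_apply v 0).trans (apply_le_iSup v 0)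
  rw [lowerPath, expRange, mul_zero, max_eq_left h1, max_eq_right (sub_nonneg.2 h2)]

theorem lowerPath_le_expRange [NeZero r] {p : ℝ} (hp : 0 < p) {u : ℝ} {z v : Fin r → ℝ}
    (h : outcome (fun _ => τ) u z = outcome (fun _ => τ) u v) :
    lowerPath τ p v u ≤ expRange p z := by
  rw [outcome_eq_iff] at h
  refine Real.rpow_le_rpow (le_max_left _ _) (max_le ?_ ?_) hp.le
  · exact sub_nonneg.2 ((iInf_le_apply z 0).trans (apply_le_iSup z 0))
  obtain ⟨i, hi⟩ := exists_eq_ciSup_of_finite (f := v)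
  obtain ⟨j, hj⟩ := exists_eq_ciInf_of_finite (f := v)
  have hzi := apply_le_iSup z i
  have hzj := iInf_le_apply z j
  have hzz := (iInf_le_apply z 0).trans (apply_le_iSup z 0)
  have hmax1 := le_max_left (⨅ i, v i) (τ * u)
  have hmax2 := le_max_right (⨅ i, v i) (τ * u)
  by_cases ei : z i = v i <;> by_cases ej : z j = v j
  · linarith
  · linarith [(h j ej).1]
  · linarith [(h i ei).2]
  · linarith [(h i ei).2]

/-- Raising all entries below `τ * u` to almost `τ * u` keeps the outcome and brings the range
arbitrarily close to the lower bound. -/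
theorem lowerBound_outcome [NeZero r] (hτ : 0 < τ) {p : ℝ} (hp : 0 < p) {u : ℝ}
    {v : Fin r → ℝ} (hv : 0 ≤ v) :
    lowerBound (fun _ => τ) p (outcome (fun _ => τ) u v) = lowerPath τ p v u := by
  apply le_antisymm
  · have key : ∀ x < u, lowerBound (fun _ => τ) p (outcome (fun _ => τ) u v) ≤
        lowerPath τ p v x := by
      intro x hx
      have hx' : τ * x < τ * u := mul_lt_mul_of_pos_left hx hτ
      set z : Fin r → ℝ := fun i => max (v i) (τ * x) with hz
      have hcons : z ∈ consistent (fun _ => τ) (outcome (fun _ => τ) u v) := by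
        rw [mem_consistent_outcome_iff, outcome_eq_iff]
        refine ⟨fun i => (hv i).trans (le_max_left _ _), fun i hi => ?_⟩
        have h1 : v i < τ * x := by
          by_contra hn
          exact hi (max_eq_left (not_lt.1 hn))
        rw [hz]
        simp only [max_eq_right h1.le]
        exact ⟨hx', h1.trans hx'⟩
      have hbdd : BddBelow (expRange p '' consistent (fun _ => τ) (outcome (fun _ => τ) u v)) := by
        refine ⟨0, ?_⟩
        rintro _ ⟨y, _, rfl⟩
        exact Real.rpow_nonneg (sub_nonneg.2 ((iInf_le_apply y 0).trans (apply_le_iSup y 0))) _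
      refine (csInf_le hbdd ⟨z, hcons, rfl⟩).trans ?_
      refine Real.rpow_le_rpow
        (sub_nonneg.2 ((iInf_le_apply z 0).trans (apply_le_iSup z 0))) ?_ hp.le
      obtain ⟨i, hi⟩ := exists_eq_ciSup_of_finite (f := z)
      obtain ⟨j, hj⟩ := exists_eq_ciInf_of_finite (f := z)
      rw [← hi, ← hj]
      have h1 : max (⨅ i, v i) (τ * x) ≤ z j := max_le_max_right _ (iInf_le_apply v j)
      rcases le_total (v i) (τ * x) with h2 | h2
      · have h3 : z i = τ * x := max_eq_right h2
        have h4 := le_max_right (⨅ i, v i) (τ * x)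
        exact le_max_of_le_left (by linarith)
      · have h3 : z i = v i := max_eq_left h2
        have h4 := apply_le_iSup v i
        exact le_max_of_le_right (by linarith)
    refine ge_of_tendsto (((continuous_lowerPath hp v).tendsto u).mono_left
      (nhdsWithin_le_nhds (s := Iio u))) ?_
    filter_upwards [self_mem_nhdsWithin] with x hx using key x hx
  · refine le_csInf ⟨_, v, ?_, rfl⟩ ?_
    · rw [mem_consistent_outcome_iff]
      exact ⟨hv, rfl⟩
    · rintro _ ⟨z, hz, rfl⟩
      rw [mem_consistent_outcome_iff] at hz
      exact lowerPath_le_expRange hp hz.2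

/-- The seeds at which the data `z` and `v` give different outcomes form an initial interval which
is closed at its right end. -/
theorem exists_forall_outcome_ne_iff (hτ : 0 < τ) (z v : Fin r → ℝ) :
    (∀ x ∈ Ioc (0 : ℝ) 1, outcome (fun _ => τ) x z = outcome (fun _ => τ) x v) ∨
    ∃ ρ ∈ Ioc (0 : ℝ) 1, ∀ x ∈ Ioc (0 : ℝ) 1,
      (outcome (fun _ => τ) x z ≠ outcome (fun _ => τ) x v ↔ x ≤ ρ) := by
  by_cases hall : ∀ x ∈ Ioc (0 : ℝ) 1, outcome (fun _ => τ) x z = outcome (fun _ => τ) x v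
  · exact Or.inl hall
  right
  push Not at hall
  obtain ⟨x₀, hx₀, hne₀⟩ := hall
  have hne_iff : ∀ x, outcome (fun _ => τ) x z ≠ outcome (fun _ => τ) x v ↔
      ∃ i, z i ≠ v i ∧ x ≤ max (z i) (v i) / τ := by
    intro x
    rw [Ne, outcome_eq_iff]
    push Not
    refine exists_congr fun i => and_congr_right fun _ => ?_
    rw [le_div_iff₀ hτ, mul_comm x, le_max_iff]
    constructor
    · intro h
      by_cases h1 : z i < τ * x
      · exact Or.inr (h h1)
      · exact Or.inl (not_lt.1 h1)
    · rintro (h | h) h1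
      · exact absurd h (not_le.2 h1)
      · exact h
  obtain ⟨i₀, hi₀, hi₀'⟩ := (hne_iff x₀).1 hne₀
  obtain ⟨k, hk, hkmax⟩ := Finset.exists_max_image (Finset.univ.filter fun i => z i ≠ v i)
    (fun i => max (z i) (v i) / τ) ⟨i₀, by simpa using hi₀⟩
  refine ⟨min 1 (max (z k) (v k) / τ), ⟨lt_min one_pos ?_, min_le_left _ _⟩, fun x hx => ?_⟩
  · exact hx₀.1.trans_le (hi₀'.trans (hkmax i₀ (by simpa using hi₀)))
  · rw [hne_iff, le_min_iff]
    constructor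
    · rintro ⟨i, hi, hix⟩
      exact ⟨hx.2, hix.trans (hkmax i (by simpa using hi))⟩
    · rintro ⟨_, h⟩
      exact ⟨k, by simpa using hk, h⟩

end Sampling

/-! ### The L estimator along one data vector -/

section LPath

/-- The L estimator along a fixed data vector, as a function of the seed `ζ`, in terms of the lower
bound function `B` of these data. -/
def lPath (B : ℝ → ℝ) (ζ : ℝ) : ℝ := B ζ / ζ - ∫ u in ζ..1, B u / u ^ 2

variable {B : ℝ → ℝ}

theorem continuousOn_div_sq (hB : Continuous B) : ContinuousOn (fun u => B u / u ^ 2) (Ioi 0) :=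
  hB.continuousOn.div (by fun_prop) fun _ hx => pow_ne_zero 2 (ne_of_gt hx)

theorem intervalIntegrable_div_sq (hB : Continuous B) {x y : ℝ} (hx : 0 < x) (hy : 0 < y) :
    IntervalIntegrable (fun u => B u / u ^ 2) volume x y := by
  refine ((continuousOn_div_sq hB).mono fun u hu => ?_).intervalIntegrable
  exact (lt_min hx hy).trans_le hu.1

theorem integral_const_div_sq (C : ℝ) {x y : ℝ} (hx : 0 < x) (hy : 0 < y) :
    ∫ u in x..y, C / u ^ 2 = C / x - C / y := by
  have hd : ∀ u ∈ uIcc x y, HasDerivAt (fun u : ℝ => -(C / u)) (C / u ^ 2) u := by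
    intro u hu
    have hu0 : u ≠ 0 := ((lt_min hx hy).trans_le hu.1).ne'
    have := ((hasDerivAt_inv hu0).const_mul C).neg
    refine (this.congr_deriv ?_).congr_of_eventuallyEq (Eventually.of_forall fun y => ?_)
    · field_simp
    · simp [div_eq_mul_inv]
  rw [intervalIntegral.integral_eq_sub_of_hasDerivAt hd
    (intervalIntegrable_div_sq continuous_const hx hy)]
  ring

theorem integral_div_sq_le (hB : Continuous B) (hanti : Antitone B) {x y : ℝ} (hx : 0 < x)
    (hxy : x ≤ y) : ∫ u in x..y, B u / u ^ 2 ≤ B x / x - B x / y := by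
  have hy := hx.trans_le hxy
  rw [← integral_const_div_sq (B x) hx hy]
  refine intervalIntegral.integral_mono_on hxy (intervalIntegrable_div_sq hB hx hy)
    (intervalIntegrable_div_sq continuous_const hx hy) fun u hu => ?_
  have := hanti hu.1
  gcongr

theorem le_integral_div_sq (hB : Continuous B) (hanti : Antitone B) {x y : ℝ} (hx : 0 < x)
    (hxy : x ≤ y) : B y / x - B y / y ≤ ∫ u in x..y, B u / u ^ 2 := by
  have hy := hx.trans_le hxy
  rw [← integral_const_div_sq (B y) hx hy]
  refine intervalIntegral.integral_mono_on hxy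
    (intervalIntegrable_div_sq continuous_const hx hy) (intervalIntegrable_div_sq hB hx hy)
    fun u hu => ?_
  have := hanti hu.2
  gcongr

theorem lPath_le_lPath (hB : Continuous B) (hanti : Antitone B) {x y : ℝ} (hx : 0 < x)
    (hxy : x ≤ y) : lPath B y ≤ lPath B x := by
  have hy := hx.trans_le hxy
  have h1 := integral_div_sq_le hB hanti hx hxy
  have h2 := intervalIntegral.integral_add_adjacent_intervals
    (intervalIntegrable_div_sq hB hx hy) (intervalIntegrable_div_sq hB hy one_pos)
  have h3 : B y / y ≤ B x / y := by
    have := hanti hxy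
    gcongr
  unfold lPath
  linarith

theorem lPath_nonneg (hB : Continuous B) (hanti : Antitone B) (h0 : ∀ u, 0 ≤ B u) {x : ℝ}
    (hx : x ∈ Ioc (0 : ℝ) 1) : 0 ≤ lPath B x := by
  refine le_trans ?_ (lPath_le_lPath hB hanti hx.1 hx.2)
  simpa [lPath] using h0 1

/-- The bounds come from splitting the integral at `√ζ`. -/
theorem tendsto_mul_integral_div_sq (hB : Continuous B) (hanti : Antitone B)
    (h0 : ∀ u, 0 ≤ B u) :
    Tendsto (fun ζ => ζ * ∫ u in ζ..1, B u / u ^ 2) (𝓝[>] 0) (𝓝 (B 0)) := by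
  have hlow : Tendsto (fun ζ => B (√ζ) * (1 - √ζ)) (𝓝[>] 0) (𝓝 (B 0)) := by
    have hc : Continuous fun ζ => B (√ζ) * (1 - √ζ) := by fun_prop
    have := (hc.tendsto 0).mono_left (nhdsWithin_le_nhds (s := Ioi 0))
    simpa using this
  refine tendsto_of_tendsto_of_tendsto_of_le_of_le' hlow tendsto_const_nhds ?_ ?_
  · filter_upwards [Ioo_mem_nhdsGT (one_pos : (0 : ℝ) < 1)] with ζ hζ
    have hs0 : 0 < √ζ := Real.sqrt_pos.2 hζ.1
    have hs1 : √ζ ≤ 1 := Real.sqrt_le_one.2 hζ.2.le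
    have hss : √ζ * √ζ = ζ := Real.mul_self_sqrt hζ.1.le
    have hζs : ζ ≤ √ζ := by nlinarith
    have h1 := le_integral_div_sq hB hanti hζ.1 hζs
    have h2 := intervalIntegral.integral_add_adjacent_intervals
      (intervalIntegrable_div_sq hB hζ.1 hs0) (intervalIntegrable_div_sq hB hs0 one_pos)
    have h3 : 0 ≤ ∫ u in √ζ..1, B u / u ^ 2 :=
      intervalIntegral.integral_nonneg hs1 fun u _ => div_nonneg (h0 u) (sq_nonneg u)
    have h4 : ζ * (B √ζ / ζ - B √ζ / √ζ) = B √ζ * (1 - √ζ) := by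
      have : ζ / √ζ = √ζ := Real.div_sqrt
      have hζ0 := hζ.1.ne'
      calc ζ * (B √ζ / ζ - B √ζ / √ζ) = B √ζ * (ζ / ζ - ζ / √ζ) := by ring
        _ = _ := by rw [this, div_self hζ0]
    rw [← h4]
    exact mul_le_mul_of_nonneg_left (by linarith) hζ.1.le
  · filter_upwards [Ioo_mem_nhdsGT (one_pos : (0 : ℝ) < 1)] with ζ hζ
    have h1 := integral_div_sq_le hB hanti hζ.1 hζ.2.le
    have h2 := hanti hζ.1.le
    have h3 := h0 ζ
    calc ζ * ∫ u in ζ..1, B u / u ^ 2 ≤ ζ * (B ζ / ζ - B ζ / 1) :=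
          mul_le_mul_of_nonneg_left h1 hζ.1.le
      _ = B ζ - ζ * B ζ := by have := hζ.1.ne'; field_simp
      _ ≤ B 0 := by nlinarith [hζ.1]

/-- An antiderivative of `lPath B` on `(0, 1]`, made continuous at `0`. -/
def lPathPrimitive (B : ℝ → ℝ) : ℝ → ℝ :=
  Function.update (fun ζ => -(ζ * ∫ u in ζ..1, B u / u ^ 2)) 0 (-B 0)

theorem hasDerivAt_lPathPrimitive (hB : Continuous B) {ζ : ℝ} (hζ : 0 < ζ) :
    HasDerivAt (lPathPrimitive B) (lPath B ζ) ζ := by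
  have h1 : HasDerivAt (fun ζ => ∫ u in ζ..1, B u / u ^ 2) (-(B ζ / ζ ^ 2)) ζ := by
    refine intervalIntegral.integral_hasDerivAt_left (intervalIntegrable_div_sq hB hζ one_pos) ?_
      ((continuousOn_div_sq hB).continuousAt (Ioi_mem_nhds hζ))
    exact (continuousOn_div_sq hB).stronglyMeasurableAtFilter isOpen_Ioi _ hζ
  have h2 := ((hasDerivAt_id ζ).mul h1).neg
  refine (h2.congr_deriv ?_).congr_of_eventuallyEq ?_
  · simp only [lPath, id]
    field_simp
    ring
  · filter_upwards [Ioi_mem_nhds hζ] with x hx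
    rw [lPathPrimitive, Function.update_of_ne (ne_of_gt hx)]
    rfl

theorem continuousOn_lPathPrimitive (hB : Continuous B) (hanti : Antitone B)
    (h0 : ∀ u, 0 ≤ B u) : ContinuousOn (lPathPrimitive B) (Ici 0) := by
  intro x hx
  rcases eq_or_lt_of_le (show (0 : ℝ) ≤ x from hx) with rfl | hx
  · rw [lPathPrimitive, continuousWithinAt_update_same, Ici_sdiff_left]
    exact (tendsto_mul_integral_div_sq hB hanti h0).neg
  · exact (hasDerivAt_lPathPrimitive hB hx).continuousAt.continuousWithinAt

theorem integrableOn_lPath (hB : Continuous B) (hanti : Antitone B) (h0 : ∀ u, 0 ≤ B u) :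
    IntegrableOn (lPath B) (Ioc 0 1) := by
  refine intervalIntegral.integrableOn_deriv_of_nonneg
    ((continuousOn_lPathPrimitive hB hanti h0).mono Icc_subset_Ici_self)
    (fun x hx => hasDerivAt_lPathPrimitive hB hx.1)
    fun x hx => lPath_nonneg hB hanti h0 ⟨hx.1, hx.2.le⟩

/-- For `ρ = 1` this is the unbiasedness of the L estimator. -/
theorem integral_lPath (hB : Continuous B) (hanti : Antitone B) (h0 : ∀ u, 0 ≤ B u) {ρ : ℝ}
    (hρ : ρ ∈ Ioc (0 : ℝ) 1) :
    ∫ u in (0 : ℝ)..ρ, lPath B u = B 0 - B ρ + ρ * lPath B ρ := by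
  rw [intervalIntegral.integral_eq_sub_of_hasDerivAt_of_le hρ.1.le
    ((continuousOn_lPathPrimitive hB hanti h0).mono Icc_subset_Ici_self)
    fun x hx => hasDerivAt_lPathPrimitive hB hx.1]
  · rw [lPathPrimitive, Function.update_self, Function.update_of_ne hρ.1.ne', lPath]
    have := hρ.1.ne'
    field_simp
    ring
  · rw [intervalIntegrable_iff_integrableOn_Ioc_of_le hρ.1.le]
    exact (integrableOn_lPath hB hanti h0).mono_set (Ioc_subset_Ioc_right hρ.2)

variable {r : ℕ} {τ : ℝ}

theorem LEstimator_outcome_eq_lPath [NeZero r] (hτ : 0 < τ) {p : ℝ} (hp : 0 < p) {ζ : ℝ}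
    (hζ : ζ ≤ 1) {v : Fin r → ℝ} (hv : 0 ≤ v) :
    LEstimator (fun _ => τ) p (outcome (fun _ => τ) ζ v) = lPath (lowerPath τ p v) ζ := by
  rw [LEstimator_outcome (fun _ => τ) (fun _ => hτ.le) p hζ v, lPath]
  simp only [lowerBound_outcome hτ hp hv]

end LPath

/-! ### Extending a path to a nonnegative unbiased estimator -/

section Extension

variable {r : ℕ} {τ : ℝ}

/-- `h` is a possible restriction, to the outcomes of one data vector with lower bound function
`B`, of a nonnegative unbiased estimator. -/
structure IsFeasiblePath (B h : ℝ → ℝ) : Prop where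
  nonneg : ∀ u ∈ Ioc (0 : ℝ) 1, 0 ≤ h u
  integrable : IntegrableOn h (Ioc 0 1)
  integral_eq : ∫ u in (0 : ℝ)..1, h u = B 0
  tail_le : ∀ x ∈ Ioc (0 : ℝ) 1, ∫ u in x..1, h u ≤ B x

/-- The constraint on the tails comes from the data that share the outcome at seed `x`: on them the
estimator already spends the tail integral. -/
theorem IsNonnegUnbiased.isFeasiblePath [NeZero r] (hτ : 0 < τ) {p : ℝ} (hp : 0 < p)
    {g : Outcome r → ℝ} (hg : IsNonnegUnbiased (fun _ => τ) p g) {v : Fin r → ℝ} (hv : 0 ≤ v) :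
    IsFeasiblePath (lowerPath τ p v) fun u => g (outcome (fun _ => τ) u v) where
  nonneg u hu := hg.nonneg u hu v hv
  integrable := hg.integrable v hv
  integral_eq := by
    rw [lowerPath_zero hv, ← hg.unbiased v hv, seedMeasure,
      intervalIntegral.integral_of_le zero_le_one]
  tail_le x hx := by
    rw [← lowerBound_outcome hτ hp hv]
    refine le_csInf ⟨_, v, ?_, rfl⟩ ?_
    · rw [mem_consistent_outcome_iff]
      exact ⟨hv, rfl⟩
    · rintro _ ⟨z, hz, rfl⟩
      rw [mem_consistent_outcome_iff] at hz
      rw [← hg.unbiased z hz.1, intervalIntegral.integral_of_le hx.2]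
      calc ∫ u in Ioc x 1, g (outcome (fun _ => τ) u v)
          = ∫ u in Ioc x 1, g (outcome (fun _ => τ) u z) := by
            refine setIntegral_congr_fun measurableSet_Ioc fun u hu => ?_
            simp only [outcome_eq_of_le hτ hu.1.le hz.2]
        _ ≤ ∫ u in Ioc 0 1, g (outcome (fun _ => τ) u z) := by
            refine setIntegral_mono_set (hg.integrable z hz.1) ?_
              (Ioc_subset_Ioc_left hx.1.le).eventuallyLE
            exact (ae_restrict_iff' measurableSet_Ioc).2
              (Eventually.of_forall fun u hu => hg.nonneg u hu z hz.1)

/-- The largest seed, not below that of `S`, at which `S` rules out the data `v` (only meaningful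
if `S` itself rules out `v`). -/
def Outcome.splitSeed (τ : ℝ) (v : Fin r → ℝ) (S : Outcome r) : ℝ :=
  sSup {x ∈ Icc S.seed 1 | S.coarsen (fun _ => τ) x ≠ outcome (fun _ => τ) x v}

open Classical in
/-- The estimator that follows `h` on the outcomes of the data `v`. On an outcome that rules out
`v`, the part of the lower bound at the splitting seed `ρ` not yet spent by `h` is spread evenly
over `(0, ρ]`, and the increase of the L estimator since the seed `ρ` is added. -/
def extendPath (τ p : ℝ) (v : Fin r → ℝ) (h : ℝ → ℝ) (S : Outcome r) : ℝ :=
  if S = outcome (fun _ => τ) S.seed v then h S.seed else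
    (lowerBound (fun _ => τ) p (S.coarsen (fun _ => τ) (S.splitSeed τ v)) -
        ∫ u in S.splitSeed τ v..1, h u) / S.splitSeed τ v +
      (LEstimator (fun _ => τ) p S -
        LEstimator (fun _ => τ) p (S.coarsen (fun _ => τ) (S.splitSeed τ v)))

theorem extendPath_of_eq {p : ℝ} {v z : Fin r → ℝ} {h : ℝ → ℝ} {u : ℝ}
    (hz : outcome (fun _ => τ) u z = outcome (fun _ => τ) u v) :
    extendPath τ p v h (outcome (fun _ => τ) u z) = h u := by
  rw [extendPath, if_pos]
  · rfl
  · rw [hz]; rfl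

theorem extendPath_of_le [NeZero r] (hτ : 0 < τ) {p : ℝ} (hp : 0 < p) {v z : Fin r → ℝ}
    (hz : 0 ≤ z) {h : ℝ → ℝ} {ρ : ℝ} (hρ : ρ ∈ Ioc (0 : ℝ) 1)
    (hsplit : ∀ x ∈ Ioc (0 : ℝ) 1,
      (outcome (fun _ => τ) x z ≠ outcome (fun _ => τ) x v ↔ x ≤ ρ))
    {u : ℝ} (hu : u ∈ Ioc 0 ρ) :
    extendPath τ p v h (outcome (fun _ => τ) u z) =
      (lowerPath τ p z ρ - ∫ x in ρ..1, h x) / ρ +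
        (lPath (lowerPath τ p z) u - lPath (lowerPath τ p z) ρ) := by
  have hseed : (outcome (fun _ => τ) u z).splitSeed τ v = ρ := by
    have : {x ∈ Icc u 1 | (outcome (fun _ => τ) u z).coarsen (fun _ => τ) x ≠
        outcome (fun _ => τ) x v} = Icc u ρ := by
      ext x
      simp only [mem_Icc]
      constructor
      · rintro ⟨hx, hne⟩
        rw [coarsen_outcome _ (fun _ => hτ.le) hx.1] at hne
        exact ⟨hx.1, (hsplit x ⟨hu.1.trans_le hx.1, hx.2⟩).1 hne⟩
      · rintro ⟨hx1, hx2⟩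
        refine ⟨⟨hx1, hx2.trans hρ.2⟩, ?_⟩
        rw [coarsen_outcome _ (fun _ => hτ.le) hx1]
        exact (hsplit x ⟨hu.1.trans_le hx1, hx2.trans hρ.2⟩).2 hx2
    rw [Outcome.splitSeed]
    exact (congrArg sSup this).trans (csSup_Icc hu.2)
  have hne : outcome (fun _ => τ) u z ≠
      outcome (fun _ => τ) (outcome (fun _ => τ) u z).seed v :=
    (hsplit u ⟨hu.1, hu.2.trans hρ.2⟩).2 hu.2
  rw [extendPath, if_neg hne, hseed, coarsen_outcome _ (fun _ => hτ.le) hu.2,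
    lowerBound_outcome hτ hp hz, LEstimator_outcome_eq_lPath hτ hp (hu.2.trans hρ.2) hz,
    LEstimator_outcome_eq_lPath hτ hp hρ.2 hz]

/-- At the splitting seed, a feasible path for `v` has spent no more than the lower bound of the
other data. -/
theorem integral_le_lowerPath_of_split [NeZero r] (hτ : 0 < τ) {p : ℝ} (hp : 0 < p)
    {v z : Fin r → ℝ} (hv : 0 ≤ v) (hz : 0 ≤ z) {h : ℝ → ℝ}
    (hh : IsFeasiblePath (lowerPath τ p v) h) {ρ : ℝ} (hρ : ρ ∈ Ioc (0 : ℝ) 1)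
    (hsplit : ∀ x ∈ Ioc (0 : ℝ) 1,
      (outcome (fun _ => τ) x z ≠ outcome (fun _ => τ) x v ↔ x ≤ ρ)) :
    ∫ x in ρ..1, h x ≤ lowerPath τ p z ρ := by
  rcases eq_or_lt_of_le hρ.2 with rfl | hρ1
  · simpa using lowerPath_nonneg z 1
  have hint : IntegrableOn h (uIcc ρ 1) := by
    rw [uIcc_of_le hρ1.le, integrableOn_Icc_iff_integrableOn_Ioc]
    exact hh.integrable.mono_set (Ioc_subset_Ioc_left hρ.1.le)
  have hcont : ContinuousWithinAt (fun y => ∫ x in y..1, h x) (Ioi ρ) ρ := by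
    have := intervalIntegral.continuousOn_primitive_interval_left hint ρ left_mem_uIcc
    rw [uIcc_of_le hρ1.le] at this
    refine this.mono_of_mem_nhdsWithin ?_
    filter_upwards [Ioo_mem_nhdsGT hρ1] with y hy using Ioo_subset_Icc_self hy
  refine le_of_tendsto_of_tendsto hcont
    (continuous_lowerPath hp z).continuousAt.continuousWithinAt ?_
  filter_upwards [Ioo_mem_nhdsGT hρ1] with y hy
  have hy' : y ∈ Ioc (0 : ℝ) 1 := ⟨hρ.1.trans hy.1, hy.2.le⟩
  have heq : outcome (fun _ => τ) y z = outcome (fun _ => τ) y v := by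
    by_contra hne
    exact absurd ((hsplit y hy').1 hne) (not_le.2 hy.1)
  have := hh.tail_le y hy'
  rwa [← lowerBound_outcome hτ hp hv, ← heq, lowerBound_outcome hτ hp hz] at this

theorem isNonnegUnbiased_extendPath [NeZero r] (hτ : 0 < τ) {p : ℝ} (hp : 0 < p)
    {v : Fin r → ℝ} (hv : 0 ≤ v) {h : ℝ → ℝ} (hh : IsFeasiblePath (lowerPath τ p v) h) :
    IsNonnegUnbiased (fun _ => τ) p (extendPath τ p v h) := by
  have hsame : ∀ z : Fin r → ℝ, 0 ≤ z →
      (∀ x ∈ Ioc (0 : ℝ) 1, outcome (fun _ => τ) x z = outcome (fun _ => τ) x v) →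
      expRange p z = expRange p v := by
    intro z hz heq
    rw [← lowerPath_zero (τ := τ) hz, ← lowerPath_zero (τ := τ) hv]
    refine tendsto_nhds_unique (((continuous_lowerPath hp z).tendsto 0).mono_left
      (nhdsWithin_le_nhds (s := Ioi 0))) ?_
    refine (((continuous_lowerPath hp v).tendsto 0).mono_left
      (nhdsWithin_le_nhds (s := Ioi 0))).congr' ?_
    filter_upwards [Ioo_mem_nhdsGT (one_pos : (0 : ℝ) < 1)] with x hx
    rw [← lowerBound_outcome hτ hp hz, ← lowerBound_outcome hτ hp hv, heq x ⟨hx.1, hx.2.le⟩]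
  have main : ∀ z : Fin r → ℝ, 0 ≤ z →
      (∀ u ∈ Ioc (0 : ℝ) 1, 0 ≤ extendPath τ p v h (outcome (fun _ => τ) u z)) ∧
      IntegrableOn (fun u => extendPath τ p v h (outcome (fun _ => τ) u z)) (Ioc 0 1) ∧
      ∫ u in Ioc 0 1, extendPath τ p v h (outcome (fun _ => τ) u z) = expRange p z := by
    intro z hz
    have hB := continuous_lowerPath (τ := τ) hp z
    have hanti := antitone_lowerPath hτ hp z
    rcases exists_forall_outcome_ne_iff hτ z v with heq | ⟨ρ, hρ, hsplit⟩
    · have hE : EqOn h (fun u => extendPath τ p v h (outcome (fun _ => τ) u z)) (Ioc 0 1) :=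
        fun u hu => (extendPath_of_eq (heq u hu)).symm
      refine ⟨fun u hu => ?_, hh.integrable.congr_fun hE measurableSet_Ioc, ?_⟩
      · rw [extendPath_of_eq (heq u hu)]
        exact hh.nonneg u hu
      · rw [← setIntegral_congr_fun measurableSet_Ioc hE,
          ← intervalIntegral.integral_of_le zero_le_one, hh.integral_eq, lowerPath_zero hv,
          hsame z hz heq]
    · set B := lowerPath τ p z with hBdef
      have hE1 : EqOn h (fun u => extendPath τ p v h (outcome (fun _ => τ) u z)) (Ioc ρ 1) := by
        intro u hu
        refine (extendPath_of_eq ?_).symm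
        by_contra hne
        exact absurd ((hsplit u ⟨hρ.1.trans hu.1, hu.2⟩).1 hne) (not_le.2 hu.1)
      have hE2 : EqOn (fun u => ((B ρ - ∫ x in ρ..1, h x) / ρ - lPath B ρ) + lPath B u)
          (fun u => extendPath τ p v h (outcome (fun _ => τ) u z)) (Ioc 0 ρ) := by
        intro u hu
        simp only [extendPath_of_le hτ hp hz hρ hsplit hu]
        ring
      have hi1 := (hh.integrable.mono_set (Ioc_subset_Ioc_left hρ.1.le)).congr_fun hE1
        measurableSet_Ioc
      have hiL : IntegrableOn (lPath B) (Ioc 0 ρ) :=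
        (integrableOn_lPath hB hanti (lowerPath_nonneg z)).mono_set (Ioc_subset_Ioc_right hρ.2)
      have hic : IntegrableOn (fun _ : ℝ => (B ρ - ∫ x in ρ..1, h x) / ρ - lPath B ρ)
          (Ioc 0 ρ) := integrableOn_const (by simp)
      have hi2 := (hic.add hiL).congr_fun hE2 measurableSet_Ioc
      have hspent := integral_le_lowerPath_of_split hτ hp hv hz hh hρ hsplit
      refine ⟨fun u hu => ?_, ?_, ?_⟩
      · rcases le_or_gt u ρ with hle | hgt
        · rw [extendPath_of_le hτ hp hz hρ hsplit ⟨hu.1, hle⟩]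
          refine add_nonneg (div_nonneg (sub_nonneg.2 hspent) hρ.1.le) (sub_nonneg.2 ?_)
          exact lPath_le_lPath hB hanti hu.1 hle
        · refine le_of_le_of_eq ?_ (hE1 ⟨hgt, hu.2⟩)
          exact hh.nonneg u hu
      · rw [← Ioc_union_Ioc_eq_Ioc hρ.1.le hρ.2]
        exact hi2.union hi1
      · rw [← Ioc_union_Ioc_eq_Ioc hρ.1.le hρ.2,
          setIntegral_union (Ioc_disjoint_Ioc_of_le le_rfl) measurableSet_Ioc hi2 hi1,
          ← setIntegral_congr_fun measurableSet_Ioc hE1,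
          ← setIntegral_congr_fun measurableSet_Ioc hE2, integral_add hic hiL,
          ← intervalIntegral.integral_of_le hρ.1.le (f := lPath B),
          integral_lPath hB hanti (lowerPath_nonneg z) hρ, setIntegral_const,
          ← intervalIntegral.integral_of_le hρ.2, hBdef, lowerPath_zero hz]
        have := hρ.1.ne'
        simp only [Real.volume_real_Ioc_of_le hρ.1.le, smul_eq_mul]
        field_simp
        ring
  exact ⟨fun u hu z hz => (main z hz).1 u hu, fun z hz => (main z hz).2.1,
    fun z hz => (main z hz).2.2⟩

end Extension

/-! ### Optimal paths and `v`-optimal estimators -/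

section OptimalPath

/-- A feasible path `w` that minimizes the second moment. The condition `le_integral_mul` is the
first-order characterization of the element of least norm of a convex set. -/
structure IsOptimalPath (B w : ℝ → ℝ) : Prop extends IsFeasiblePath B w where
  memLp : MemLp w 2 seedMeasure
  le_integral_mul : ∀ q, IsFeasiblePath B q → MemLp q 2 seedMeasure →
    ∫ u in (0 : ℝ)..1, w u ^ 2 ≤ ∫ u in (0 : ℝ)..1, q u * w u

instance : IsProbabilityMeasure seedMeasure := ⟨by simp [seedMeasure]⟩

theorem integral_seedMeasure (f : ℝ → ℝ) : ∫ u, f u ∂seedMeasure = ∫ u in (0 : ℝ)..1, f u := by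
  rw [seedMeasure, intervalIntegral.integral_of_le zero_le_one]

theorem lintegral_sq_eq_ofReal {f : ℝ → ℝ} (hf : Integrable (fun u => f u ^ 2) seedMeasure) :
    ∫⁻ u, ENNReal.ofReal (f u ^ 2) ∂seedMeasure =
      ENNReal.ofReal (∫ u in (0 : ℝ)..1, f u ^ 2) := by
  rw [← integral_seedMeasure,
    ofReal_integral_eq_lintegral_ofReal hf (Eventually.of_forall fun u => sq_nonneg _)]

theorem lintegral_sq_eq_top {f : ℝ → ℝ} (hf : AEStronglyMeasurable f seedMeasure)
    (h2 : ¬ MemLp f 2 seedMeasure) : ∫⁻ u, ENNReal.ofReal (f u ^ 2) ∂seedMeasure = ∞ := by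
  by_contra hne
  refine h2 ((memLp_two_iff_integrable_sq hf).2 ⟨hf.pow 2, ?_⟩)
  rw [hasFiniteIntegral_iff_ofReal (Eventually.of_forall fun u => sq_nonneg _)]
  exact lt_top_iff_ne_top.2 hne

variable {B w : ℝ → ℝ}

theorem IsOptimalPath.integral_sq_le (hw : IsOptimalPath B w) {q : ℝ → ℝ}
    (hq : IsFeasiblePath B q) (hq2 : MemLp q 2 seedMeasure) :
    ∫ u in (0 : ℝ)..1, w u ^ 2 ≤ ∫ u in (0 : ℝ)..1, q u ^ 2 := by
  have h1 := hw.le_integral_mul q hq hq2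
  have h2 : 0 ≤ ∫ u, (q u - w u) ^ 2 ∂seedMeasure := integral_nonneg fun u => sq_nonneg _
  have hqw : Integrable (fun u => q u * w u) seedMeasure := hq2.integrable_mul hw.memLp
  have h3 : ∫ u, (q u - w u) ^ 2 ∂seedMeasure = (∫ u, q u ^ 2 ∂seedMeasure) -
      2 * (∫ u, q u * w u ∂seedMeasure) + ∫ u, w u ^ 2 ∂seedMeasure := by
    have h4 : Integrable (fun u => q u ^ 2 - 2 * (q u * w u)) seedMeasure :=
      hq2.integrable_sq.sub (hqw.const_mul 2)
    rw [← integral_const_mul, ← integral_sub hq2.integrable_sq (hqw.const_mul 2),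
      ← integral_add h4 hw.memLp.integrable_sq]
    refine integral_congr_ae (Eventually.of_forall fun u => ?_)
    simp only
    ring
  simp only [integral_seedMeasure] at h2 h3
  linarith

theorem IsOptimalPath.lintegral_sq_le (hw : IsOptimalPath B w) {q : ℝ → ℝ}
    (hq : IsFeasiblePath B q) :
    ∫⁻ u, ENNReal.ofReal (w u ^ 2) ∂seedMeasure ≤ ∫⁻ u, ENNReal.ofReal (q u ^ 2) ∂seedMeasure := by
  by_cases h2 : MemLp q 2 seedMeasure
  · rw [lintegral_sq_eq_ofReal hw.memLp.integrable_sq, lintegral_sq_eq_ofReal h2.integrable_sq]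
    exact ENNReal.ofReal_le_ofReal (hw.integral_sq_le hq h2)
  · rw [lintegral_sq_eq_top hq.integrable.aestronglyMeasurable h2]
    exact le_top

variable {r : ℕ} {τ : ℝ}

theorem estVariance_eq {p : ℝ} {g : Outcome r → ℝ} {θ : Fin r → ℝ}
    (hg : IsNonnegUnbiased θ p g) {v : Fin r → ℝ} (hv : 0 ≤ v) :
    estVariance θ g v = secondMoment θ g v - ENNReal.ofReal (expRange p v ^ 2) := by
  rw [estVariance, evariance_def' (hg.integrable v hv).aestronglyMeasurable, hg.unbiased v hv,
    secondMoment]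
  congr 1
  refine lintegral_congr fun u => ?_
  rw [Real.enorm_eq_ofReal_abs, ← ENNReal.ofReal_pow (abs_nonneg _), sq_abs]

theorem secondMoment_extendPath {p : ℝ} (v : Fin r → ℝ) (w : ℝ → ℝ) :
    secondMoment (fun _ => τ) (extendPath τ p v w) v =
      ∫⁻ u, ENNReal.ofReal (w u ^ 2) ∂seedMeasure := by
  simp only [secondMoment, extendPath_of_eq rfl]

theorem IsOptimalPath.isVOptimal [NeZero r] (hτ : 0 < τ) {p : ℝ} (hp : 0 < p) {v : Fin r → ℝ}
    (hv : 0 ≤ v) (hw : IsOptimalPath (lowerPath τ p v) w) :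
    IsVOptimal (fun _ => τ) p v (extendPath τ p v w) := by
  have hE := isNonnegUnbiased_extendPath hτ hp hv hw.toIsFeasiblePath
  refine ⟨hE, fun g hg => ?_⟩
  rw [estVariance_eq hE hv, estVariance_eq hg hv, secondMoment_extendPath]
  exact tsub_le_tsub_right (hw.lintegral_sq_le (hg.isFeasiblePath hτ hp hv)) _

/-- An optimal path for the lower bound function `B` exists, and the second moment of the L estimator
is at most `C` times its second moment. -/
def HasLRatioLE (B : ℝ → ℝ) (C : ℝ) : Prop :=
  ∃ w, IsOptimalPath B w ∧ Integrable (fun u => lPath B u ^ 2) seedMeasure ∧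
    ∫ u in (0 : ℝ)..1, lPath B u ^ 2 ≤ C * ∫ u in (0 : ℝ)..1, w u ^ 2

theorem secondMoment_LEstimator [NeZero r] (hτ : 0 < τ) {p : ℝ} (hp : 0 < p) {v : Fin r → ℝ}
    (hv : 0 ≤ v) (hL : Integrable (fun u => lPath (lowerPath τ p v) u ^ 2) seedMeasure) :
    secondMoment (fun _ => τ) (LEstimator (fun _ => τ) p) v =
      ENNReal.ofReal (∫ u in (0 : ℝ)..1, lPath (lowerPath τ p v) u ^ 2) := by
  rw [← lintegral_sq_eq_ofReal hL, secondMoment, seedMeasure]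
  refine setLIntegral_congr_fun measurableSet_Ioc fun u hu => ?_
  simp only [LEstimator_outcome_eq_lPath hτ hp hu.2 hv]

theorem HasLRatioLE.secondMoment_le [NeZero r] (hτ : 0 < τ) {p : ℝ} (hp : 0 < p)
    {v : Fin r → ℝ} (hv : 0 ≤ v) {C : ℝ} (hC : 0 ≤ C)
    (h : HasLRatioLE (lowerPath τ p v) C) :
    (∃ g, IsVOptimal (fun _ => τ) p v g) ∧
    ∀ g, IsVOptimal (fun _ => τ) p v g →
      secondMoment (fun _ => τ) (LEstimator (fun _ => τ) p) v ≤
        ENNReal.ofReal C * secondMoment (fun _ => τ) g v := by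
  obtain ⟨w, hw, hL, hle⟩ := h
  refine ⟨⟨_, hw.isVOptimal hτ hp hv⟩, fun g hg => ?_⟩
  rw [secondMoment_LEstimator hτ hp hv hL]
  calc ENNReal.ofReal (∫ u in (0 : ℝ)..1, lPath (lowerPath τ p v) u ^ 2)
      ≤ ENNReal.ofReal (C * ∫ u in (0 : ℝ)..1, w u ^ 2) := ENNReal.ofReal_le_ofReal hle
    _ = ENNReal.ofReal C * ∫⁻ u, ENNReal.ofReal (w u ^ 2) ∂seedMeasure := by
        rw [ENNReal.ofReal_mul hC, lintegral_sq_eq_ofReal hw.memLp.integrable_sq]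
    _ ≤ _ := by
        gcongr
        exact hw.lintegral_sq_le (hg.1.isFeasiblePath hτ hp hv)

theorem IsFeasiblePath.const_mul {q : ℝ → ℝ} (hq : IsFeasiblePath B q) {κ : ℝ} (hκ : 0 ≤ κ) :
    IsFeasiblePath (fun u => κ * B u) fun u => κ * q u where
  nonneg u hu := mul_nonneg hκ (hq.nonneg u hu)
  integrable := hq.integrable.const_mul κ
  integral_eq := by rw [intervalIntegral.integral_const_mul, hq.integral_eq]
  tail_le x hx := by
    rw [intervalIntegral.integral_const_mul]
    exact mul_le_mul_of_nonneg_left (hq.tail_le x hx) hκ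

theorem IsOptimalPath.const_mul (hw : IsOptimalPath B w) {κ : ℝ} (hκ : 0 < κ) :
    IsOptimalPath (fun u => κ * B u) fun u => κ * w u where
  toIsFeasiblePath := hw.toIsFeasiblePath.const_mul hκ.le
  memLp := hw.memLp.const_mul κ
  le_integral_mul q hq hq2 := by
    have h1 := hq.const_mul (inv_nonneg.2 hκ.le)
    simp only [inv_mul_cancel_left₀ hκ.ne'] at h1
    have h2 := hw.le_integral_mul _ h1 (hq2.const_mul κ⁻¹)
    simp only [mul_pow, mul_left_comm _ κ]
    rw [intervalIntegral.integral_const_mul, intervalIntegral.integral_const_mul]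
    simp only [mul_assoc] at h2
    rw [intervalIntegral.integral_const_mul] at h2
    calc κ ^ 2 * ∫ u in (0 : ℝ)..1, w u ^ 2
        ≤ κ ^ 2 * (κ⁻¹ * ∫ u in (0 : ℝ)..1, q u * w u) := by gcongr
      _ = _ := by field_simp

theorem lPath_const_mul (κ ζ : ℝ) : lPath (fun u => κ * B u) ζ = κ * lPath B ζ := by
  simp only [lPath, mul_div_assoc]
  rw [intervalIntegral.integral_const_mul]
  ring

theorem HasLRatioLE.const_mul {C : ℝ} (h : HasLRatioLE B C) {κ : ℝ} (hκ : 0 < κ) :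
    HasLRatioLE (fun u => κ * B u) C := by
  obtain ⟨w, hw, hL, hle⟩ := h
  refine ⟨_, hw.const_mul hκ, ?_, ?_⟩
  · simp only [lPath_const_mul, mul_pow]
    exact hL.const_mul _
  · simp only [lPath_const_mul, mul_pow]
    rw [intervalIntegral.integral_const_mul, intervalIntegral.integral_const_mul,
      mul_left_comm]
    gcongr

/-- The tight ratio, from the bound for all data and one vector of data for which it is attained;
the lower bound function of the latter is given up to a positive factor. -/
theorem lHasTightRatio_of [NeZero r] (hτ : 0 < τ) {p : ℝ} (hp : 0 < p) {C : ℝ} (hC : 0 ≤ C)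
    (hall : ∀ v : Fin r → ℝ, 0 ≤ v → HasLRatioLE (lowerPath τ p v) C)
    {v₀ : Fin r → ℝ} (hv₀ : 0 ≤ v₀) {κ : ℝ} (hκ : 0 < κ)
    (hB : lowerPath τ p v₀ = fun u => κ * B u) (hw : IsOptimalPath B w)
    (hL : Integrable (fun u => lPath B u ^ 2) seedMeasure)
    (hpos : 0 < ∫ u in (0 : ℝ)..1, w u ^ 2)
    (heq : ∫ u in (0 : ℝ)..1, lPath B u ^ 2 = C * ∫ u in (0 : ℝ)..1, w u ^ 2) :
    LHasTightRatio (fun _ : Fin r => τ) p (ENNReal.ofReal C) := by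
  have hw' := hw.const_mul hκ
  have hL' : Integrable (fun u => lPath (lowerPath τ p v₀) u ^ 2) seedMeasure := by
    simp only [hB, lPath_const_mul, mul_pow]
    exact hL.const_mul _
  have heq' : ∫ u in (0 : ℝ)..1, lPath (lowerPath τ p v₀) u ^ 2 =
      C * ∫ u in (0 : ℝ)..1, (κ * w u) ^ 2 := by
    simp only [hB, lPath_const_mul, mul_pow]
    rw [intervalIntegral.integral_const_mul, intervalIntegral.integral_const_mul, heq]
    ring
  have hpos' : 0 < ∫ u in (0 : ℝ)..1, (κ * w u) ^ 2 := by
    simp only [mul_pow]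
    rw [intervalIntegral.integral_const_mul]
    positivity
  refine ⟨fun v hv => (hall v hv).secondMoment_le hτ hp hv hC, v₀, hv₀,
    extendPath τ p v₀ fun u => κ * w u, (hB ▸ hw').isVOptimal hτ hp hv₀, ?_⟩
  rw [secondMoment_extendPath, lintegral_sq_eq_ofReal hw'.memLp.integrable_sq,
    secondMoment_LEstimator hτ hp hv₀ hL', heq', ENNReal.ofReal_mul hC]
  exact ⟨ENNReal.ofReal_pos.2 hpos', ENNReal.ofReal_lt_top, rfl⟩

end OptimalPath

/-! ### Second moment of the L estimator -/

section SecondMoment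

/-- The lower bound function `B` is constant on `(0, b]`, has derivative `B'` on `(b, e)`, and on
`[e, 1]` it vanishes unless `e = 1`. The function `lam` is the primitive of `B' x / x` whose value
at `e` is that of the L estimator. -/
structure IsLProfile (B B' lam : ℝ → ℝ) (b e : ℝ) : Prop where
  pos : 0 < e
  le_one : e ≤ 1
  nonneg : 0 ≤ b
  le : b ≤ e
  continuous : Continuous B
  const : ∀ u, u ≤ b → B u = B b
  vanish : e = 1 ∨ ∀ u, e ≤ u → B u = 0
  deriv : ∀ x ∈ Ioo b e, HasDerivAt B (B' x) x
  deriv_lam : ∀ x ∈ Ioo b e, HasDerivAt lam (B' x / x) x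
  continuousOn_lam : ContinuousOn lam (Ioi 0)
  lam_end : lam e = B e / e

variable {B B' lam : ℝ → ℝ} {b e : ℝ}

theorem IsLProfile.lPath_of_gt (h : IsLProfile B B' lam b e) {ζ : ℝ} (h1 : e < ζ) (h2 : ζ ≤ 1) :
    lPath B ζ = 0 := by
  have hv : ∀ u, e ≤ u → B u = 0 := by
    rcases h.vanish with he | hv
    · exact absurd (h1.trans_le h2) (by rw [he]; exact lt_irrefl _)
    · exact hv
  rw [lPath, hv ζ h1.le, zero_div, zero_sub, neg_eq_zero]
  refine intervalIntegral.integral_zero_ae (Eventually.of_forall fun u hu => ?_)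
  rw [uIoc_of_le h2] at hu
  rw [hv u (h1.le.trans hu.1.le), zero_div]

theorem IsLProfile.lPath_of_mem (h : IsLProfile B B' lam b e) {ζ : ℝ} (h0 : 0 < ζ) (h1 : b ≤ ζ)
    (h2 : ζ ≤ e) : lPath B ζ = lam ζ := by
  have hint := fun {x y : ℝ} => intervalIntegrable_div_sq (x := x) (y := y) h.continuous
  have hI : ∫ u in e..1, B u / u ^ 2 = 0 := by
    rcases h.vanish with he | hv
    · rw [he, intervalIntegral.integral_same]
    · refine intervalIntegral.integral_zero_ae (Eventually.of_forall fun u hu => ?_)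
      rw [uIoc_of_le h.le_one] at hu
      rw [hv u hu.1.le, zero_div]
  have hJ : ∫ u in ζ..e, B u / u ^ 2 = (lam e - B e / e) - (lam ζ - B ζ / ζ) := by
    refine intervalIntegral.integral_eq_sub_of_hasDerivAt_of_le
      (f := fun x => lam x - B x / x) h2 ?_ ?_ (hint h0 h.pos)
    · refine ((h.continuousOn_lam.mono ?_).sub (h.continuous.continuousOn.div continuousOn_id ?_))
      · exact fun x hx => h0.trans_le hx.1
      · exact fun x hx => (h0.trans_le hx.1).ne'
    · intro x hx
      have hx0 : x ≠ 0 := (h0.trans hx.1).ne'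
      have hx' : x ∈ Ioo b e := ⟨h1.trans_lt hx.1, hx.2⟩
      refine ((h.deriv_lam x hx').sub ((h.deriv x hx').div (hasDerivAt_id x) hx0)).congr_deriv ?_
      simp only [id]
      field_simp
      ring
  rw [lPath, ← intervalIntegral.integral_add_adjacent_intervals (hint h0 h.pos)
    (hint h.pos one_pos), hI, hJ, h.lam_end]
  ring

theorem IsLProfile.lPath_of_le (h : IsLProfile B B' lam b e) {ζ : ℝ} (h0 : 0 < ζ) (h1 : ζ ≤ b) :
    lPath B ζ = lam b := by
  have hb := h0.trans_le h1
  have hint := fun {x y : ℝ} => intervalIntegrable_div_sq (x := x) (y := y) h.continuous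
  have hJ : ∫ u in ζ..b, B u / u ^ 2 = B b / ζ - B b / b := by
    rw [← integral_const_div_sq (B b) h0 hb]
    refine intervalIntegral.integral_congr fun u hu => ?_
    rw [uIcc_of_le h1] at hu
    simp only [h.const u hu.2]
  rw [← h.lPath_of_mem hb le_rfl h.le, lPath, lPath,
    ← intervalIntegral.integral_add_adjacent_intervals (hint h0 hb) (hint hb one_pos), hJ,
    h.const ζ h1]
  ring

/-- Where `B` varies, `x * lam x ^ 2 - N x` is a primitive of the square of the L estimator. -/
theorem IsLProfile.sq_lPath (h : IsLProfile B B' lam b e) {N : ℝ → ℝ}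
    (hN : ∀ x ∈ Ioo b e, HasDerivAt N (2 * lam x * B' x) x) (hNc : ContinuousOn N (Icc b e))
    (hlc : ContinuousOn (fun x => x * lam x ^ 2) (Icc b e)) :
    Integrable (fun u => lPath B u ^ 2) seedMeasure ∧
      ∫ u in (0 : ℝ)..1, lPath B u ^ 2 = e * lam e ^ 2 - N e + N b := by
  have hd : ∀ x ∈ Ioo b e, HasDerivAt (fun x => x * lam x ^ 2 - N x) (lam x ^ 2) x := by
    intro x hx
    have hx0 : x ≠ 0 := (h.nonneg.trans_lt hx.1).ne'
    refine (((hasDerivAt_id x).mul ((h.deriv_lam x hx).pow 2)).sub (hN x hx)).congr_deriv ?_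
    simp only [id, Pi.pow_apply]
    field_simp
    ring
  have hc : ContinuousOn (fun x => x * lam x ^ 2 - N x) (Icc b e) := hlc.sub hNc
  have hi := intervalIntegral.integrableOn_deriv_of_nonneg hc hd fun x _ => sq_nonneg _
  have hE1 : EqOn (fun _ : ℝ => lam b ^ 2) (fun u => lPath B u ^ 2) (Ioc 0 b) := fun u hu => by
    simp only [h.lPath_of_le hu.1 hu.2]
  have hE2 : EqOn (fun u => lam u ^ 2) (fun u => lPath B u ^ 2) (Ioc b e) := fun u hu => by
    simp only [h.lPath_of_mem (h.nonneg.trans_lt hu.1) hu.1.le hu.2]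
  have hE3 : EqOn (fun _ : ℝ => (0 : ℝ)) (fun u => lPath B u ^ 2) (Ioc e 1) := fun u hu => by
    simp only [h.lPath_of_gt hu.1 hu.2, zero_pow two_ne_zero]
  have hi1 := (integrableOn_const (by simp) : IntegrableOn (fun _ : ℝ => lam b ^ 2)
    (Ioc 0 b)).congr_fun hE1 measurableSet_Ioc
  have hi2 := hi.congr_fun hE2 measurableSet_Ioc
  have hi3 := (integrableOn_zero : IntegrableOn (fun _ : ℝ => (0 : ℝ))
    (Ioc e 1)).congr_fun hE3 measurableSet_Ioc
  have hi12 := hi1.union hi2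
  rw [Ioc_union_Ioc_eq_Ioc h.nonneg h.le] at hi12
  have hi123 := hi12.union hi3
  rw [Ioc_union_Ioc_eq_Ioc h.pos.le h.le_one] at hi123
  refine ⟨hi123, ?_⟩
  rw [intervalIntegral.integral_of_le zero_le_one, ← Ioc_union_Ioc_eq_Ioc h.pos.le h.le_one,
    setIntegral_union (Ioc_disjoint_Ioc_of_le le_rfl) measurableSet_Ioc hi12 hi3,
    ← Ioc_union_Ioc_eq_Ioc h.nonneg h.le,
    setIntegral_union (Ioc_disjoint_Ioc_of_le le_rfl) measurableSet_Ioc hi1 hi2,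
    ← setIntegral_congr_fun measurableSet_Ioc hE1, ← setIntegral_congr_fun measurableSet_Ioc hE2,
    ← setIntegral_congr_fun measurableSet_Ioc hE3, ← intervalIntegral.integral_of_le h.le,
    intervalIntegral.integral_eq_sub_of_hasDerivAt_of_le h.le hc hd
      ((intervalIntegrable_iff_integrableOn_Ioc_of_le h.le).2 hi),
    setIntegral_const, integral_zero, Real.volume_real_Ioc_of_le h.nonneg, smul_eq_mul]
  ring

theorem continuousOn_mul_log_sq : ContinuousOn (fun x : ℝ => x * Real.log x ^ 2) (Ici 0) := by
  have h1 : Continuous fun x : ℝ => (2 * (√x * Real.log √x)) ^ 2 :=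
    ((Real.continuous_mul_log.comp Real.continuous_sqrt).const_mul 2).pow 2
  refine h1.continuousOn.congr fun x hx => ?_
  simp only [Real.log_sqrt hx, mul_pow, Real.sq_sqrt (show (0 : ℝ) ≤ x from hx)]
  ring

/-! ### Constant paths -/

theorem isOptimalPath_const {f : ℝ} (hf : 0 ≤ f) (h0 : B 0 = f)
    (hB : ∀ x ∈ Ioc (0 : ℝ) 1, f * (1 - x) ≤ B x) : IsOptimalPath B fun _ => f where
  nonneg _ _ := hf
  integrable := integrableOn_const (by simp)
  integral_eq := by simp [h0]
  tail_le x hx := by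
    rw [intervalIntegral.integral_const, smul_eq_mul, mul_comm]
    exact hB x hx
  memLp := memLp_const f
  le_integral_mul q hq _ := by
    rw [intervalIntegral.integral_mul_const, hq.integral_eq, h0]
    simp [sq]

/-- A lower bound function that is constant on `[0, 1]` is estimated without error. -/
theorem hasLRatioLE_of_const {f C : ℝ} (hf : 0 ≤ f) (hB : ∀ u ∈ Icc (0 : ℝ) 1, B u = f)
    (hC : 1 ≤ C) : HasLRatioLE B C := by
  have hL : EqOn (fun _ : ℝ => f ^ 2) (fun u => lPath B u ^ 2) (Ioc 0 1) := by
    intro ζ hζ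
    have h1 : ∫ u in ζ..1, B u / u ^ 2 = f / ζ - f / 1 := by
      rw [← integral_const_div_sq f hζ.1 one_pos]
      refine intervalIntegral.integral_congr fun u hu => ?_
      rw [uIcc_of_le hζ.2] at hu
      simp only [hB u ⟨hζ.1.le.trans hu.1, hu.2⟩]
    simp only [lPath, h1, hB ζ ⟨hζ.1.le, hζ.2⟩]
    ring
  refine ⟨fun _ => f, isOptimalPath_const hf (hB 0 ⟨le_rfl, zero_le_one⟩) fun x hx => ?_, ?_, ?_⟩
  · rw [hB x ⟨hx.1.le, hx.2⟩]
    nlinarith [hx.1]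
  · exact (integrableOn_const (by simp) :
      IntegrableOn (fun _ : ℝ => f ^ 2) (Ioc 0 1)).congr_fun hL measurableSet_Ioc
  · rw [intervalIntegral.integral_of_le zero_le_one,
      intervalIntegral.integral_of_le zero_le_one, ← setIntegral_congr_fun measurableSet_Ioc hL]
    exact le_mul_of_one_le_left (integral_nonneg fun _ => sq_nonneg _) hC

end SecondMoment

/-! ### The range -/

section Range

/-- The lower bound function of the range, in units of the threshold, of data with maximum `a` and
minimum `b`. -/
def cut (a b u : ℝ) : ℝ := max 0 (a - max b u)

variable {a b e u : ℝ}

theorem cut_of_le (hba : b ≤ a) (h : u ≤ b) : cut a b u = a - b := by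
  rw [cut, max_eq_left h, max_eq_right (sub_nonneg.2 hba)]

theorem cut_of_mem (h1 : b ≤ u) (h2 : u ≤ a) : cut a b u = a - u := by
  rw [cut, max_eq_right h1, max_eq_right (sub_nonneg.2 h2)]

theorem cut_of_ge (h : a ≤ u) : cut a b u = 0 := by
  rw [cut, max_eq_left]
  have := le_max_right b u
  linarith

theorem cut_zero (hb : 0 ≤ b) (hba : b ≤ a) : cut a b 0 = a - b := cut_of_le hba hb

theorem continuous_cut : Continuous (cut a b) := by
  unfold cut
  fun_prop

theorem hasDerivAt_cut (h : u ∈ Ioo b a) : HasDerivAt (cut a b) (-1) u := by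
  refine ((hasDerivAt_id u).const_sub a).congr_of_eventuallyEq ?_
  filter_upwards [Ioo_mem_nhds h.1 h.2] with x hx
  exact cut_of_mem hx.1.le hx.2.le

theorem continuousOn_log_Ioi : ContinuousOn Real.log (Ioi 0) :=
  Real.continuousOn_log.mono fun _ hx => ne_of_gt hx

theorem cut_eq_of_one_le (hba : b ≤ a) (hb1 : 1 ≤ b) {u : ℝ} (hu : u ∈ Icc (0 : ℝ) 1) :
    cut a b u = a - b := cut_of_le hba (hu.2.trans hb1)

theorem cut_self_eq : cut a a u = 0 := by
  rw [cut, max_eq_left]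
  have := le_max_left a u
  linarith

/-- `e = min a 1`, in the form of a case distinction. -/
def IsEnd (a e : ℝ) : Prop := (e = a ∧ a ≤ 1) ∨ (e = 1 ∧ 1 ≤ a)

theorem IsEnd.le (h : IsEnd a e) : e ≤ a := by
  rcases h with ⟨h1, _⟩ | ⟨h1, h2⟩ <;> linarith

theorem IsEnd.le_one (h : IsEnd a e) : e ≤ 1 := by
  rcases h with ⟨h1, _⟩ | ⟨h1, h2⟩ <;> linarith

theorem exists_isEnd (hba : b < a) (hb1 : b < 1) : ∃ e, IsEnd a e ∧ b < e := by
  rcases le_total a 1 with h | h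
  · exact ⟨a, Or.inl ⟨rfl, h⟩, hba⟩
  · exact ⟨1, Or.inr ⟨rfl, h⟩, hb1⟩

theorem isLProfile_cut (hb : 0 ≤ b) (he : IsEnd a e) (hbe : b < e) :
    IsLProfile (cut a b) (fun _ => -1) (fun x => (a - e) + Real.log e - Real.log x) b e where
  pos := hb.trans_lt hbe
  le_one := he.le_one
  nonneg := hb
  le := hbe.le
  continuous := continuous_cut
  const u hu := by
    rw [cut_of_le (hbe.le.trans he.le) hu, cut_of_le (hbe.le.trans he.le) le_rfl]
  vanish := by
    rcases he with ⟨h1, _⟩ | ⟨h1, _⟩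
    · exact Or.inr fun u hu => cut_of_ge (h1 ▸ hu)
    · exact Or.inl h1
  deriv x hx := hasDerivAt_cut ⟨hx.1, hx.2.trans_le he.le⟩
  deriv_lam x hx := by
    have hx0 : x ≠ 0 := (hb.trans_lt hx.1).ne'
    refine ((Real.hasDerivAt_log hx0).const_sub _).congr_deriv ?_
    field_simp
  continuousOn_lam := continuousOn_const.sub continuousOn_log_Ioi
  lam_end := by
    rw [cut_of_mem hbe.le he.le]
    rcases he with ⟨h1, _⟩ | ⟨h1, _⟩ <;> rw [h1] <;> simp

theorem sq_lPath_cut (hb : 0 ≤ b) (he : IsEnd a e) (hbe : b < e) :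
    Integrable (fun u => lPath (cut a b) u ^ 2) seedMeasure ∧
      ∫ u in (0 : ℝ)..1, lPath (cut a b) u ^ 2 =
        e * (a - e) ^ 2 + 2 * (e - b) * (a - e) + 2 * (e - b) +
          2 * (b * Real.log b - b * Real.log e) := by
  have hP := isLProfile_cut hb he hbe
  have hsub : Icc b e ⊆ Ici 0 := fun x hx => hb.trans hx.1
  have hmain := hP.sq_lPath
    (N := fun x => -2 * (((a - e) + Real.log e) * x - (x * Real.log x - x))) ?_ ?_ ?_
  · refine ⟨hmain.1, hmain.2.trans ?_⟩
    ring
  · intro x hx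
    have hx0 : x ≠ 0 := (hb.trans_lt hx.1).ne'
    refine ((((hasDerivAt_id x).const_mul ((a - e) + Real.log e)).sub
      ((Real.hasDerivAt_mul_log hx0).sub (hasDerivAt_id x))).const_mul (-2)).congr_deriv ?_
    ring
  · have := Real.continuous_mul_log
    fun_prop
  · have h1 : ContinuousOn (fun x : ℝ => ((a - e) + Real.log e) ^ 2 * x -
        2 * ((a - e) + Real.log e) * (x * Real.log x) + x * Real.log x ^ 2) (Icc b e) := by
      refine ContinuousOn.add ?_ (continuousOn_mul_log_sq.mono hsub)
      have := Real.continuous_mul_log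
      fun_prop
    refine h1.congr fun x _ => ?_
    ring

/-- If `B` vanishes from `a` on, the chord from `(0, B 0)` to `(a, 0)` is optimal as soon as it lies
below `B`. -/
theorem isOptimalPath_step {B : ℝ → ℝ} {γ : ℝ} (ha : a ∈ Ioc (0 : ℝ) 1) (hγ : 0 ≤ γ)
    (h0 : B 0 = γ * a) (h1 : ∀ x, 0 ≤ x → x ≤ a → γ * (a - x) ≤ B x) (h2 : ∀ x, a ≤ x → B x = 0) :
    IsOptimalPath B fun u => if u ≤ a then γ else 0 := by
  have hgt : ∀ q : ℝ → ℝ, ∀ x, a ≤ x → x ≤ 1 →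
      ∫ u in x..1, q u * (if u ≤ a then γ else 0) = 0 := by
    intro q x hx hx1
    refine intervalIntegral.integral_zero_ae (Eventually.of_forall fun u hu => ?_)
    rw [uIoc_of_le hx1] at hu
    rw [if_neg (not_le.2 (hx.trans_lt hu.1)), mul_zero]
  have hmul : ∀ q : ℝ → ℝ, IntegrableOn q (Ioc 0 1) → ∀ x, 0 ≤ x → x ≤ a →
      ∫ u in x..1, q u * (if u ≤ a then γ else 0) = γ * ∫ u in x..a, q u := by
    intro q hq x hx hxa
    have hE : EqOn (fun u => γ * q u) (fun u => q u * (if u ≤ a then γ else 0)) (Ioc x a) := by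
      intro u hu
      simp only [if_pos hu.2, mul_comm]
    have hE' : EqOn (fun _ => (0 : ℝ)) (fun u => q u * (if u ≤ a then γ else 0)) (Ioc a 1) := by
      intro u hu
      simp only [if_neg (not_le.2 hu.1), mul_zero]
    have i1 : IntervalIntegrable (fun u => q u * (if u ≤ a then γ else 0)) volume x a := by
      rw [intervalIntegrable_iff_integrableOn_Ioc_of_le hxa]
      exact IntegrableOn.congr_fun (Integrable.const_mul (hq.mono_set (Ioc_subset_Ioc hx ha.2)) γ)
        hE measurableSet_Ioc
    have i2 : IntervalIntegrable (fun u => q u * (if u ≤ a then γ else 0)) volume a 1 := by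
      rw [intervalIntegrable_iff_integrableOn_Ioc_of_le ha.2]
      exact integrableOn_zero.congr_fun hE' measurableSet_Ioc
    rw [← intervalIntegral.integral_add_adjacent_intervals i1 i2, hgt q a le_rfl ha.2, add_zero,
      intervalIntegral.integral_of_le hxa, intervalIntegral.integral_of_le hxa,
      ← integral_const_mul]
    exact (setIntegral_congr_fun measurableSet_Ioc hE).symm
  have hone : ∀ x, 0 ≤ x → x ≤ a →
      ∫ u in x..1, (if u ≤ a then γ else 0) = γ * (a - x) := by
    intro x hx hxa
    have := hmul (fun _ => 1) (integrableOn_const (by simp)) x hx hxa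
    simpa using this
  have hmeas : Measurable fun u : ℝ => if u ≤ a then γ else 0 :=
    Measurable.ite measurableSet_Iic measurable_const measurable_const
  have hL2 : MemLp (fun u : ℝ => if u ≤ a then γ else 0) 2 seedMeasure := by
    refine MemLp.of_bound hmeas.aestronglyMeasurable γ (Eventually.of_forall fun u => ?_)
    split_ifs
    · rw [Real.norm_of_nonneg hγ]
    · simpa using hγ
  refine ⟨⟨fun u _ => ?_, hL2.integrable one_le_two, ?_, fun x hx => ?_⟩, hL2, fun q hq _ => ?_⟩
  · split_ifs
    exacts [hγ, le_rfl]
  · rw [hone 0 le_rfl ha.1.le, h0, sub_zero]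
  · rcases le_total x a with hxa | hxa
    · rw [hone x hx.1.le hxa]
      exact h1 x hx.1.le hxa
    · have := hgt (fun _ => 1) x hxa hx.2
      simp only [one_mul] at this
      rw [this, h2 x hxa]
  · simp only [sq]
    rw [hmul _ (hL2.integrable one_le_two) 0 le_rfl ha.1.le, hmul q hq.integrable 0 le_rfl ha.1.le]
    have hq1 : ∫ u in (0 : ℝ)..a, q u = B 0 - ∫ u in a..1, q u := by
      have i1 : IntervalIntegrable q volume 0 a := by
        rw [intervalIntegrable_iff_integrableOn_Ioc_of_le ha.1.le]
        exact hq.integrable.mono_set (Ioc_subset_Ioc_right ha.2)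
      have i2 : IntervalIntegrable q volume a 1 := by
        rw [intervalIntegrable_iff_integrableOn_Ioc_of_le ha.2]
        exact hq.integrable.mono_set (Ioc_subset_Ioc_left ha.1.le)
      rw [← hq.integral_eq, ← intervalIntegral.integral_add_adjacent_intervals i1 i2]
      ring
    have hw1 : ∫ u in (0 : ℝ)..a, (if u ≤ a then γ else 0) = γ * a := by
      rw [intervalIntegral.integral_congr (g := fun _ => γ)]
      · simp [mul_comm]
      · intro u hu
        rw [uIcc_of_le ha.1.le] at hu
        exact if_pos hu.2
    have hq2 := hq.tail_le a ha
    rw [h2 a le_rfl] at hq2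
    rw [hq1, hw1, h0]
    gcongr
    linarith

theorem integral_sq_step {γ : ℝ} (ha : a ∈ Ioc (0 : ℝ) 1) :
    ∫ u in (0 : ℝ)..1, (if u ≤ a then γ else 0) ^ 2 = γ ^ 2 * a := by
  have h := (isOptimalPath_step (B := fun x => γ ^ 2 * max 0 (a - x)) ha (sq_nonneg γ)
    (by simp [max_eq_right ha.1.le]) (fun x _ hx => by rw [max_eq_right (sub_nonneg.2 hx)])
    fun x hx => by rw [max_eq_left (sub_nonpos.2 hx), mul_zero]).integral_eq
  simp only [sub_zero, max_eq_right ha.1.le] at h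
  rw [← h]
  refine intervalIntegral.integral_congr fun u _ => ?_
  split_ifs <;> simp

theorem mul_log_sub_le (hb : 0 ≤ b) (he : 0 < e) :
    b * Real.log b - b * Real.log e ≤ b * (b / e - 1) := by
  rcases hb.eq_or_lt with rfl | hb
  · simp
  · rw [← mul_sub, ← Real.log_div hb.ne' he.ne']
    exact mul_le_mul_of_nonneg_left (Real.log_le_sub_one_of_pos (div_pos hb he)) hb.le

theorem isOptimalPath_cut (hb : 0 ≤ b) (hba : b < a) (ha1 : a ≤ 1) :
    IsOptimalPath (cut a b) fun u => if u ≤ a then (a - b) / a else 0 := by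
  have ha : 0 < a := hb.trans_lt hba
  refine isOptimalPath_step ⟨ha, ha1⟩ (div_nonneg (by linarith) ha.le) ?_ (fun x hx hxa => ?_)
    fun x hx => cut_of_ge hx
  · rw [cut_zero hb hba.le]
    field_simp
  · rw [div_mul_eq_mul_div, div_le_iff₀ ha]
    rcases le_total x b with h | h
    · rw [cut_of_le hba.le h]
      nlinarith
    · rw [cut_of_mem h hxa]
      nlinarith

theorem hasLRatioLE_cut (hb : 0 ≤ b) (hba : b ≤ a) : HasLRatioLE (cut a b) 2 := by
  rcases hba.eq_or_lt with rfl | hba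
  · exact hasLRatioLE_of_const le_rfl (fun u _ => cut_self_eq) one_le_two
  rcases le_or_gt 1 b with hb1 | hb1
  · exact hasLRatioLE_of_const (sub_nonneg.2 hba.le)
      (fun u hu => cut_eq_of_one_le hba.le hb1 hu) one_le_two
  obtain ⟨e, he, hbe⟩ := exists_isEnd hba hb1
  obtain ⟨hint, heq⟩ := sq_lPath_cut hb he hbe
  have hlog := mul_log_sub_le hb (hb.trans_lt hbe)
  rcases he with ⟨rfl, ha1⟩ | ⟨rfl, ha1⟩
  · have he : 0 < e := hb.trans_lt hbe
    refine ⟨_, isOptimalPath_cut hb hba ha1, hint, ?_⟩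
    rw [heq, integral_sq_step ⟨he, ha1⟩]
    have h1 : 2 * (((e - b) / e) ^ 2 * e) = 2 * (e - b) + 2 * (b * (b / e - 1)) := by
      field_simp
      ring
    rw [h1]
    linarith
  · refine ⟨_, isOptimalPath_const (sub_nonneg.2 hba.le) (cut_zero hb hba.le)
      fun x hx => ?_, hint, ?_⟩
    · rcases le_total x b with h | h
      · rw [cut_of_le hba.le h]
        nlinarith [hx.1]
      · rw [cut_of_mem h (hx.2.trans ha1)]
        nlinarith [hx.1, mul_nonneg (sub_nonneg.2 hx.2) hb,
          mul_nonneg hx.1.le (sub_nonneg.2 ha1)]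
    · rw [heq]
      simp only [intervalIntegral.integral_const, smul_eq_mul]
      rw [div_one] at hlog
      nlinarith [sq_nonneg (a - 1), mul_nonneg (sub_nonneg.2 ha1) (sub_nonneg.2 hb1.le)]

end Range

/-! ### The squared range: paths along the convex minorant -/

section SquaredRange

variable {a b e s t : ℝ}

/-- Both sides are the double integral of `q u` over `t < y < s` and `y < u`, up to the constant
`t ∫ q`. -/
theorem integral_mul_clamp {q : ℝ → ℝ} (hq : IntegrableOn q (Ioc 0 1)) (ht : 0 ≤ t)
    (hts : t ≤ s) (hs : s ≤ 1) :
    ∫ u in (0 : ℝ)..1, q u * max t (min u s) =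
      t * (∫ u in (0 : ℝ)..1, q u) + ∫ y in t..s, ∫ u in y..1, q u := by
  set F : ℝ → ℝ → ℝ := fun y u => if y < u then q u else 0 with hF
  have hint : Integrable (Function.uncurry F)
      ((volume.restrict (Ioc t s)).prod (volume.restrict (Ioc 0 1))) := by
    have h1 : Integrable (fun p : ℝ × ℝ => q p.2)
      ((volume.restrict (Ioc t s)).prod (volume.restrict (Ioc 0 1))) :=
      Integrable.comp_snd hq (volume.restrict (Ioc t s))
    refine (h1.indicator (measurableSet_lt measurable_fst measurable_snd)).congr
      (Eventually.of_forall fun p => ?_)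
    simp only [indicator, Function.uncurry, hF, mem_ofPred_eq]
  have hinner : ∫ y in t..s, ∫ u in y..1, q u =
      ∫ y in Ioc t s, ∫ u in Ioc 0 1, F y u := by
    rw [intervalIntegral.integral_of_le hts]
    refine setIntegral_congr_fun measurableSet_Ioc fun y hy => ?_
    have : (fun u => F y u) = (Ioi y).indicator q := by
      ext u
      simp only [hF, indicator, mem_Ioi]
    simp only [this]
    rw [setIntegral_indicator measurableSet_Ioi, intervalIntegral.integral_of_le (hy.2.trans hs),
      Ioc_inter_Ioi, sup_eq_right.2 (ht.trans hy.1.le)]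
  have houter : ∀ u, ∫ y in Ioc t s, F y u = q u * (max t (min u s) - t) := by
    intro u
    have : (fun y => F y u) = (Iio u).indicator fun _ => q u := by
      ext y
      simp only [hF, indicator, mem_Iio]
    rw [this, setIntegral_indicator measurableSet_Iio, setIntegral_const, smul_eq_mul, mul_comm]
    have hae : (Ioc t s ∩ Iio u : Set ℝ) =ᵐ[volume] (Ioc t s ∩ Iic u : Set ℝ) :=
      (ae_eq_refl _).inter Iio_ae_eq_Iic
    rw [measureReal_congr hae, Ioc_inter_Iic, Real.volume_real_Ioc]
    congr 1
    rw [min_comm u s, ← max_sub_sub_right, sub_self, max_comm]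
  rw [hinner, integral_integral_swap hint]
  simp only [houter, intervalIntegral.integral_of_le (zero_le_one (α := ℝ))]
  rw [← integral_const_mul, ← integral_add (Integrable.const_mul hq t)]
  · refine setIntegral_congr_fun measurableSet_Ioc fun u _ => ?_
    ring
  · have h2 := hint.integral_prod_right
    simpa only [Function.uncurry, houter] using h2

theorem integral_sub_sq (x y : ℝ) :
    ∫ u in x..y, (a - u) ^ 2 = ((a - x) ^ 3 - (a - y) ^ 3) / 3 := by
  rw [intervalIntegral.integral_comp_sub_left (fun u => u ^ 2) a, integral_pow]
  norm_num

/-- The parameters of the greatest convex minorant of the points `(0, (a - b) ^ 2)`, `(1, 0)` and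
the graph of `(a - u) ^ 2` on `[b, 1]`: it is tangent to the graph at `t` and `s`, follows it
between them, and is affine on `[0, t]` and `[s, 1]`. For `a ≤ 1` it follows the graph up to its
vertex `s = a`. -/
structure IsMinorantCurve (a b t s : ℝ) : Prop where
  nonneg : 0 ≤ b
  le_left : b ≤ t
  left_le : t ≤ s
  right_le : s ≤ a
  le_one : s ≤ 1
  sq_left : t ^ 2 = a ^ 2 - (a - b) ^ 2
  right_eq : s = a ∨ s = 2 - a

/-- The slope, with the opposite sign, of the convex minorant. -/
def curvePath (a t s u : ℝ) : ℝ := 2 * (a - max t (min u s))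

theorem continuous_curvePath : Continuous (curvePath a t s) := by
  unfold curvePath
  fun_prop

theorem IsMinorantCurve.integral_of_ge (h : IsMinorantCurve a b t s) {x : ℝ} (h1 : s ≤ x)
    (h2 : x ≤ 1) : ∫ u in x..1, curvePath a t s u = 2 * (a - s) * (1 - x) := by
  rw [intervalIntegral.integral_congr (g := fun _ => 2 * (a - s))]
  · simp only [intervalIntegral.integral_const, smul_eq_mul]
    ring
  · intro u hu
    rw [uIcc_of_le h2] at hu
    simp only [curvePath, min_eq_right (h1.trans hu.1), max_eq_right h.left_le]

theorem IsMinorantCurve.integral_of_mem (h : IsMinorantCurve a b t s) {x : ℝ} (h1 : t ≤ x)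
    (h2 : x ≤ s) : ∫ u in x..1, curvePath a t s u = (a - x) ^ 2 := by
  have hi := fun x y => (continuous_curvePath (a := a) (t := t) (s := s)).intervalIntegrable
    (μ := volume) x y
  rw [← intervalIntegral.integral_add_adjacent_intervals (hi x s) (hi s 1),
    h.integral_of_ge le_rfl h.le_one,
    intervalIntegral.integral_congr (g := fun u => 2 * (a - u))]
  · rw [intervalIntegral.integral_const_mul, intervalIntegral.integral_sub (by simp) (by simp),
      intervalIntegral.integral_const, integral_id, smul_eq_mul]
    rcases h.right_eq with rfl | rfl <;> ring
  · intro u hu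
    rw [uIcc_of_le h2] at hu
    simp only [curvePath, min_eq_left hu.2, max_eq_right (h1.trans hu.1)]

theorem IsMinorantCurve.integral_of_le (h : IsMinorantCurve a b t s) {x : ℝ} (h1 : x ≤ t) :
    ∫ u in x..1, curvePath a t s u = (a - t) ^ 2 + 2 * (a - t) * (t - x) := by
  have hi := fun x y => (continuous_curvePath (a := a) (t := t) (s := s)).intervalIntegrable
    (μ := volume) x y
  rw [← intervalIntegral.integral_add_adjacent_intervals (hi x t) (hi t 1),
    h.integral_of_mem le_rfl h.left_le,
    intervalIntegral.integral_congr (g := fun u => 2 * (a - t))]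
  · simp only [intervalIntegral.integral_const, smul_eq_mul]
    ring
  · intro u hu
    rw [uIcc_of_le h1] at hu
    simp only [curvePath, min_eq_left (hu.2.trans h.left_le), max_eq_left hu.2]

theorem IsMinorantCurve.isFeasiblePath (h : IsMinorantCurve a b t s) :
    IsFeasiblePath (fun u => cut a b u ^ 2) (curvePath a t s) where
  nonneg u _ := by
    have : max t (min u s) ≤ a := max_le (h.left_le.trans h.right_le) ((min_le_right _ _).trans
      h.right_le)
    unfold curvePath
    linarith
  integrable := (continuous_curvePath.integrableOn_Icc (a := 0) (b := 1)).mono_set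
    Ioc_subset_Icc_self
  integral_eq := by
    rw [h.integral_of_le (h.nonneg.trans h.le_left),
      cut_zero h.nonneg (h.le_left.trans (h.left_le.trans h.right_le))]
    linarith [h.sq_left]
  tail_le x hx := by
    have hta := h.left_le.trans h.right_le
    have hba := h.le_left.trans hta
    rcases le_total x t with hxt | hxt
    · rw [h.integral_of_le hxt]
      rcases le_total x b with hxb | hxb
      · rw [cut_of_le hba hxb]
        nlinarith [h.sq_left, hx.1]
      · rw [cut_of_mem hxb (hxt.trans hta)]
        nlinarith [sq_nonneg (x - t)]
    rcases le_total x s with hxs | hxs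
    · rw [h.integral_of_mem hxt hxs, cut_of_mem (h.le_left.trans hxt) (hxs.trans h.right_le)]
    · rw [h.integral_of_ge hxs hx.2]
      rcases h.right_eq with hs | hs
      · rw [hs]
        simpa using sq_nonneg (cut a b x)
      · have hxa : x ≤ a := by linarith [hx.2, h.le_one]
        rw [cut_of_mem (h.le_left.trans hxt) hxa, hs]
        nlinarith [sq_nonneg (a - 1 - (1 - x))]

theorem IsMinorantCurve.integral_mul (h : IsMinorantCurve a b t s) {q : ℝ → ℝ}
    (hq : IsFeasiblePath (fun u => cut a b u ^ 2) q) :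
    ∫ u in (0 : ℝ)..1, q u * curvePath a t s u =
      2 * (a - t) * (a - b) ^ 2 - 2 * ∫ y in t..s, ∫ u in y..1, q u := by
  have ht := h.nonneg.trans h.le_left
  have h1 := integral_mul_clamp hq.integrable ht h.left_le h.le_one
  have hi : IntervalIntegrable q volume 0 1 :=
    (intervalIntegrable_iff_integrableOn_Ioc_of_le zero_le_one).2 hq.integrable
  have h2 : ∫ u in (0 : ℝ)..1, q u * curvePath a t s u =
      2 * a * (∫ u in (0 : ℝ)..1, q u) - 2 * ∫ u in (0 : ℝ)..1, q u * max t (min u s) := by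
    rw [← intervalIntegral.integral_const_mul, ← intervalIntegral.integral_const_mul,
      ← intervalIntegral.integral_sub (hi.const_mul _)
        ((hi.mul_continuousOn (by fun_prop)).const_mul _)]
    refine intervalIntegral.integral_congr fun u _ => ?_
    simp only [curvePath]
    ring
  rw [h2, h1, hq.integral_eq, cut_zero h.nonneg (h.le_left.trans (h.left_le.trans h.right_le))]
  ring

theorem IsMinorantCurve.integral_sq (h : IsMinorantCurve a b t s) :
    ∫ u in (0 : ℝ)..1, curvePath a t s u ^ 2 =
      2 * (a - t) * (a - b) ^ 2 - 2 / 3 * ((a - t) ^ 3 - (a - s) ^ 3) := by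
  simp only [sq (curvePath a t s _)]
  rw [h.integral_mul h.isFeasiblePath,
    intervalIntegral.integral_congr (a := t) (g := fun y => (a - y) ^ 2), integral_sub_sq]
  · ring
  · intro y hy
    rw [uIcc_of_le h.left_le] at hy
    exact h.integral_of_mem hy.1 hy.2

theorem IsMinorantCurve.isOptimalPath (h : IsMinorantCurve a b t s) :
    IsOptimalPath (fun u => cut a b u ^ 2) (curvePath a t s) where
  toIsFeasiblePath := h.isFeasiblePath
  memLp := by
    obtain ⟨C, hC⟩ := (isCompact_Icc (a := (0 : ℝ)) (b := 1)).exists_bound_of_continuousOn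
      (continuous_curvePath (a := a) (t := t) (s := s)).continuousOn
    refine MemLp.of_bound continuous_curvePath.aestronglyMeasurable C ?_
    exact (ae_restrict_iff' measurableSet_Ioc).2
      (Eventually.of_forall fun u hu => hC u (Ioc_subset_Icc_self hu))
  le_integral_mul q hq _ := by
    simp only [sq (curvePath a t s _)]
    rw [h.integral_mul h.isFeasiblePath, h.integral_mul hq]
    have hmono : ∫ y in t..s, ∫ u in y..1, q u ≤
        ∫ y in t..s, ∫ u in y..1, curvePath a t s u := by
      have hc : ∀ f : ℝ → ℝ, IntegrableOn f (Ioc 0 1) →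
          IntervalIntegrable (fun y => ∫ u in y..1, f u) volume t s := by
        intro f hf
        refine ContinuousOn.intervalIntegrable ?_
        have hf' : IntegrableOn f (uIcc 0 1) := by
          rwa [uIcc_of_le zero_le_one, integrableOn_Icc_iff_integrableOn_Ioc]
        refine (intervalIntegral.continuousOn_primitive_interval_left hf').mono ?_
        rw [uIcc_of_le h.left_le, uIcc_of_le zero_le_one]
        exact Icc_subset_Icc (h.nonneg.trans h.le_left) h.le_one
      refine intervalIntegral.integral_mono_on_of_le_Ioo h.left_le (hc q hq.integrable)
        (hc _ h.isFeasiblePath.integrable) fun y hy => ?_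
      have hty := h.nonneg.trans h.le_left
      refine (hq.tail_le y ⟨hty.trans_lt hy.1, hy.2.le.trans h.le_one⟩).trans ?_
      rw [h.integral_of_mem hy.1.le hy.2.le,
        cut_of_mem (h.le_left.trans hy.1.le) (hy.2.le.trans h.right_le)]
    linarith

/-! ### The squared range: second moment of the L estimator -/

theorem isLProfile_cut_sq (hb : 0 ≤ b) (he : IsEnd a e) (hbe : b < e) :
    IsLProfile (fun u => cut a b u ^ 2) (fun x => -2 * (a - x))
      (fun x => ((a - e) ^ 2 + 2 * a * Real.log e - 2 * e) + 2 * x - 2 * a * Real.log x) b e where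
  pos := hb.trans_lt hbe
  le_one := he.le_one
  nonneg := hb
  le := hbe.le
  continuous := continuous_cut.pow 2
  const u hu := by
    rw [cut_of_le (hbe.le.trans he.le) hu, cut_of_le (hbe.le.trans he.le) le_rfl]
  vanish := by
    rcases he with ⟨h1, _⟩ | ⟨h1, _⟩
    · exact Or.inr fun u hu => by rw [cut_of_ge (h1 ▸ hu), zero_pow two_ne_zero]
    · exact Or.inl h1
  deriv x hx := by
    refine ((hasDerivAt_cut ⟨hx.1, hx.2.trans_le he.le⟩).pow 2).congr_deriv ?_
    rw [cut_of_mem hx.1.le (hx.2.le.trans he.le)]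
    norm_num
  deriv_lam x hx := by
    have hx0 : x ≠ 0 := (hb.trans_lt hx.1).ne'
    refine ((((hasDerivAt_id x).const_mul 2).const_add _).sub
      ((Real.hasDerivAt_log hx0).const_mul (2 * a))).congr_deriv ?_
    field_simp
    ring
  continuousOn_lam := by
    have := continuousOn_log_Ioi
    fun_prop
  lam_end := by
    rw [cut_of_mem hbe.le he.le]
    rcases he with ⟨h1, _⟩ | ⟨h1, _⟩ <;> rw [h1] <;> simp

/-- A primitive of `4 (a - x) (K + 2 x - 2 a log x)`. -/
def cutSqPrimitive (a K x : ℝ) : ℝ :=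
  4 * (a * K * x + (a - K) / 2 * x ^ 2 - 2 / 3 * x ^ 3 + 2 * a ^ 2 * x -
    2 * a ^ 2 * (x * Real.log x) + a * (x * (x * Real.log x)))

theorem hasDerivAt_cutSqPrimitive {K x : ℝ} (hx : x ≠ 0) :
    HasDerivAt (cutSqPrimitive a K) (4 * (a - x) * (K + 2 * x - 2 * a * Real.log x)) x := by
  have hl := Real.hasDerivAt_mul_log hx
  have hid := hasDerivAt_id x
  have h := (((((hid.const_mul (a * K)).add ((hid.pow 2).const_mul ((a - K) / 2))).sub
    ((hid.pow 3).const_mul (2 / 3))).add (hid.const_mul (2 * a ^ 2))).sub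
    (hl.const_mul (2 * a ^ 2))).add ((hid.mul hl).const_mul a)
  refine (h.const_mul 4).congr_deriv ?_
  simp only [id]
  push_cast
  ring

theorem continuous_cutSqPrimitive {K : ℝ} : Continuous (cutSqPrimitive a K) := by
  have := Real.continuous_mul_log
  unfold cutSqPrimitive
  fun_prop

theorem sq_lPath_cut_sq (hb : 0 ≤ b) (he : IsEnd a e) (hbe : b < e) :
    Integrable (fun u => lPath (fun u => cut a b u ^ 2) u ^ 2) seedMeasure ∧
      ∫ u in (0 : ℝ)..1, lPath (fun u => cut a b u ^ 2) u ^ 2 =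
        e * (a - e) ^ 4 + cutSqPrimitive a ((a - e) ^ 2 + 2 * a * Real.log e - 2 * e) e -
          cutSqPrimitive a ((a - e) ^ 2 + 2 * a * Real.log e - 2 * e) b := by
  set K := (a - e) ^ 2 + 2 * a * Real.log e - 2 * e with hK
  have hP := isLProfile_cut_sq hb he hbe
  rw [← hK] at hP
  have hsub : Icc b e ⊆ Ici 0 := fun x hx => hb.trans hx.1
  have hmain := hP.sq_lPath (N := fun x => -cutSqPrimitive a K x) ?_ ?_ ?_
  · refine ⟨hmain.1, hmain.2.trans ?_⟩
    have : K + 2 * e - 2 * a * Real.log e = (a - e) ^ 2 := by rw [hK]; ring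
    rw [this]
    ring
  · intro x hx
    have hx0 : x ≠ 0 := (hb.trans_lt hx.1).ne'
    refine (hasDerivAt_cutSqPrimitive hx0).neg.congr_deriv ?_
    ring
  · exact continuous_cutSqPrimitive.neg.continuousOn
  · have h1 : ContinuousOn (fun x : ℝ => x * (K + 2 * x) ^ 2 -
        4 * a * (K + 2 * x) * (x * Real.log x) + 4 * a ^ 2 * (x * Real.log x ^ 2)) (Icc b e) := by
      refine ContinuousOn.add ?_ ((continuousOn_mul_log_sq.mono hsub).const_mul _)
      have := Real.continuous_mul_log
      fun_prop
    refine h1.congr fun x _ => ?_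
    ring

end SquaredRange

/-! ### The squared range: comparison of the second moments -/

section Comparison

/-- If `k` increases up to `m` and decreases from there on, and `k 1` is nonnegative, then `k` stays
nonnegative once it is. -/
theorem nonneg_of_unimodal {k k' : ℝ → ℝ} {m : ℝ} (hd : ∀ x ∈ Ioc (0 : ℝ) 1, HasDerivAt k (k' x) x)
    (hinc : ∀ x ∈ Ioc (0 : ℝ) 1, x ≤ m → 0 ≤ k' x) (hdec : ∀ x ∈ Ioc (0 : ℝ) 1, m ≤ x → k' x ≤ 0)
    (h1 : 0 ≤ k 1) {x y : ℝ} (hx : 0 < x) (hxy : x ≤ y) (hy : y ≤ 1) (hk : 0 ≤ k x) : 0 ≤ k y := by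
  have hsub : ∀ {p q : ℝ}, 0 < p → q ≤ 1 → ∀ z ∈ Icc p q, z ∈ Ioc (0 : ℝ) 1 :=
    fun hp hq z hz => ⟨hp.trans_le hz.1, hz.2.trans hq⟩
  rcases le_total y m with hm | hm
  · have hmono : MonotoneOn k (Icc x y) := by
      refine monotoneOn_of_hasDerivWithinAt_nonneg (f' := k') (convex_Icc x y)
        (fun z hz => (hd z (hsub hx hy z hz)).continuousAt.continuousWithinAt)
        (fun z hz => (hd z (hsub hx hy z (interior_subset hz))).hasDerivWithinAt) fun z hz => ?_
      exact hinc z (hsub hx hy z (interior_subset hz)) ((interior_subset hz).2.trans hm)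
    exact hk.trans (hmono (left_mem_Icc.2 hxy) (right_mem_Icc.2 hxy) hxy)
  · have hy0 := hx.trans_le hxy
    have hanti : AntitoneOn k (Icc y 1) := by
      refine antitoneOn_of_hasDerivWithinAt_nonpos (f' := k') (convex_Icc y 1)
        (fun z hz => (hd z (hsub hy0 le_rfl z hz)).continuousAt.continuousWithinAt)
        (fun z hz => (hd z (hsub hy0 le_rfl z (interior_subset hz))).hasDerivWithinAt)
        fun z hz => ?_
      exact hdec z (hsub hy0 le_rfl z (interior_subset hz)) (hm.trans (interior_subset hz).1)
    exact h1.trans (hanti (left_mem_Icc.2 hy) (right_mem_Icc.2 hy) hy)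

/-- `D` has derivative `-g k` with `g ≥ 0`, and `k` stays nonnegative once it is. So `D` increases
while `k < 0` and decreases afterwards. -/
structure IsUnimodal (D g k : ℝ → ℝ) : Prop where
  continuousOn : ContinuousOn D (Icc 0 1)
  deriv : ∀ x ∈ Ioo (0 : ℝ) 1, HasDerivAt D (-(g x * k x)) x
  factor_nonneg : ∀ x ∈ Ioo (0 : ℝ) 1, 0 ≤ g x
  nonneg_of_le : ∀ x y, 0 < x → x ≤ y → y ≤ 1 → 0 ≤ k x → 0 ≤ k y

theorem IsUnimodal.apply_le_of_nonneg {D g k : ℝ → ℝ} (h : IsUnimodal D g k) {b y : ℝ} (hb : 0 < b)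
    (hby : b ≤ y) (hy : y ≤ 1) (hk : 0 ≤ k b) : D y ≤ D b := by
  have hanti : AntitoneOn D (Icc b y) := by
    have hi : ∀ z ∈ interior (Icc b y), z ∈ Ioo (0 : ℝ) 1 ∧ b ≤ z := fun z hz => by
      rw [interior_Icc] at hz
      exact ⟨⟨hb.trans hz.1, hz.2.trans_le hy⟩, hz.1.le⟩
    refine antitoneOn_of_hasDerivWithinAt_nonpos (f' := fun x => -(g x * k x)) (convex_Icc b y)
      (h.continuousOn.mono (Icc_subset_Icc hb.le hy))
      (fun z hz => (h.deriv z (hi z hz).1).hasDerivWithinAt) fun z hz => ?_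
    obtain ⟨hz1, hz2⟩ := hi z hz
    exact neg_nonpos.2 (mul_nonneg (h.factor_nonneg z hz1)
      (h.nonneg_of_le b z hb hz2 hz1.2.le hk))
  exact hanti (left_mem_Icc.2 hby) (right_mem_Icc.2 hby) hby

theorem IsUnimodal.le_apply_of_neg {D g k : ℝ → ℝ} (h : IsUnimodal D g k) {b y : ℝ} (hy : 0 ≤ y)
    (hyb : y ≤ b) (hb : b ≤ 1) (hk : k b < 0) : D y ≤ D b := by
  have hmono : MonotoneOn D (Icc y b) := by
    have hi : ∀ z ∈ interior (Icc y b), z ∈ Ioo (0 : ℝ) 1 ∧ z ≤ b := fun z hz => by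
      rw [interior_Icc] at hz
      exact ⟨⟨hy.trans_lt hz.1, hz.2.trans_le hb⟩, hz.2.le⟩
    refine monotoneOn_of_hasDerivWithinAt_nonneg (f' := fun x => -(g x * k x)) (convex_Icc y b)
      (h.continuousOn.mono (Icc_subset_Icc hy hb))
      (fun z hz => (h.deriv z (hi z hz).1).hasDerivWithinAt) fun z hz => ?_
    obtain ⟨hz1, hz2⟩ := hi z hz
    refine neg_nonneg.2 (mul_nonpos_of_nonneg_of_nonpos (h.factor_nonneg z hz1) ?_)
    by_contra hn
    exact absurd (h.nonneg_of_le z b hz1.1 hz2 hb (not_le.1 hn).le) (not_le.2 hk)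
  exact hmono (left_mem_Icc.2 hyb) (right_mem_Icc.2 hyb) hyb

variable {a b s : ℝ}

/-- For `a ≥ 1`, the second moment of the L estimator of the squared range. -/
def lMoment (a b : ℝ) : ℝ :=
  (a - 1) ^ 4 + cutSqPrimitive a ((a - 1) ^ 2 - 2) 1 - cutSqPrimitive a ((a - 1) ^ 2 - 2) b

/-- For `a ≥ 1`, the value of the L estimator of the squared range on the seeds below `b`. -/
def lStart (a b : ℝ) : ℝ := (a - 1) ^ 2 - 2 + 2 * b - 2 * a * Real.log b

theorem hasDerivAt_lMoment (hb : b ≠ 0) :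
    HasDerivAt (lMoment a) (-(4 * (a - b) * lStart a b)) b :=
  (hasDerivAt_cutSqPrimitive hb).const_sub _

theorem continuous_lMoment : Continuous (lMoment a) := continuous_const.sub continuous_cutSqPrimitive

theorem lMoment_one : lMoment a 1 = (a - 1) ^ 4 := by simp [lMoment]

theorem lMoment_zero :
    lMoment a 0 = (a - 1) ^ 4 + 2 * (a - 1) ^ 2 * (2 * a - 1) +
      8 * (a ^ 2 - 3 / 4 * a + 1 / 6) := by
  simp only [lMoment, cutSqPrimitive, Real.log_one]
  ring

theorem lStart_one : lStart a 1 = (a - 1) ^ 2 := by simp [lStart]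

theorem hasDerivAt_lStart (hb : b ≠ 0) : HasDerivAt (lStart a) (-(2 * (a - b) / b)) b := by
  refine ((((hasDerivAt_id b).const_mul 2).const_add _).sub
    ((Real.hasDerivAt_log hb).const_mul (2 * a))).congr_deriv ?_
  field_simp
  ring

/-- The point `t` at which the tangent to the graph of `(a - u) ^ 2` passes through
`(0, (a - b) ^ 2)`. -/
def leftTangent (a b : ℝ) : ℝ := √(a ^ 2 - (a - b) ^ 2)

/-- The second moment of the path along the convex minorant. -/
def curveMoment (a s b : ℝ) : ℝ :=
  2 * (a - leftTangent a b) * (a - b) ^ 2 - 2 / 3 * ((a - leftTangent a b) ^ 3 - (a - s) ^ 3)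

theorem leftTangent_sq (hb : 0 ≤ b) (hba : b ≤ a) : leftTangent a b ^ 2 = a ^ 2 - (a - b) ^ 2 :=
  Real.sq_sqrt (by nlinarith)

theorem leftTangent_pos (hb : 0 < b) (hba : b ≤ a) : 0 < leftTangent a b :=
  Real.sqrt_pos.2 (by nlinarith)

theorem hasDerivAt_leftTangent (hb : 0 < b) (hba : b ≤ a) :
    HasDerivAt (leftTangent a) ((a - b) / leftTangent a b) b := by
  have h0 : a ^ 2 - (a - b) ^ 2 ≠ 0 := by nlinarith
  refine (((((hasDerivAt_id b).const_sub a).pow 2).const_sub (a ^ 2)).sqrt h0).congr_deriv ?_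
  have h1 : leftTangent a b ≠ 0 := (leftTangent_pos hb hba).ne'
  simp only [id, Pi.pow_apply]
  change _ / (2 * leftTangent a b) = _
  field_simp
  norm_num
  ring

theorem continuous_leftTangent : Continuous (leftTangent a) := by
  unfold leftTangent
  fun_prop

/-- The derivative is that of `(a - b) ^ 2`, times twice the initial slope of the convex minorant. -/
theorem hasDerivAt_curveMoment (hb : 0 < b) (hba : b ≤ a) :
    HasDerivAt (curveMoment a s) (-(8 * (a - b) * (a - leftTangent a b))) b := by
  have h1 : leftTangent a b ≠ 0 := (leftTangent_pos hb hba).ne'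
  have hsq := leftTangent_sq hb.le hba
  have hT := (hasDerivAt_leftTangent hb hba).const_sub a
  refine ((((hT.const_mul 2).mul (((hasDerivAt_id b).const_sub a).pow 2))).sub
    (((hT.pow 3).sub_const ((a - s) ^ 3)).const_mul (2 / 3))).congr_deriv ?_
  simp only [id, Pi.pow_apply]
  push_cast
  field_simp
  linear_combination (-(2 : ℝ)) * (a - b) * hsq

theorem isUnimodal_line (ha : 1 ≤ a) :
    IsUnimodal (fun b => 5 / 2 * (a - b) ^ 4 - lMoment a b) (fun b => 4 * (a - b))
      fun b => 5 / 2 * (a - b) ^ 2 - lStart a b where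
  continuousOn := by
    have := continuous_lMoment (a := a)
    fun_prop
  deriv x hx := by
    refine (((((hasDerivAt_id x).const_sub a).pow 4).const_mul (5 / 2)).sub
      (hasDerivAt_lMoment hx.1.ne')).congr_deriv ?_
    simp only [id]
    push_cast
    ring
  factor_nonneg x hx := by linarith [hx.2]
  nonneg_of_le x y hx hxy hy hk := by
    refine nonneg_of_unimodal (k := fun b => 5 / 2 * (a - b) ^ 2 - lStart a b)
      (k' := fun b => (a - b) * (2 / b - 5)) (m := 2 / 5) ?_ ?_ ?_ ?_ hx hxy hy hk
    · intro z hz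
      have hz0 := hz.1.ne'
      refine (((((hasDerivAt_id z).const_sub a).pow 2).const_mul (5 / 2)).sub
        (hasDerivAt_lStart hz0)).congr_deriv ?_
      simp only [id]
      field_simp
      ring
    · intro z hz hm
      have : 5 ≤ 2 / z := by rw [le_div_iff₀ hz.1]; linarith
      exact mul_nonneg (by linarith [hz.2]) (by linarith)
    · intro z hz hm
      have : 2 / z ≤ 5 := by rw [div_le_iff₀ hz.1]; linarith
      exact mul_nonpos_of_nonneg_of_nonpos (by linarith [hz.2]) (by linarith)
    · simp only [lStart_one]
      nlinarith [sq_nonneg (a - 1)]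

theorem isUnimodal_curve (ha : 1 ≤ a) (ha2 : a ≤ 2) :
    IsUnimodal (fun b => 5 / 2 * curveMoment a s b - lMoment a b) (fun b => 4 * (a - b))
      fun b => 5 * (a - leftTangent a b) - lStart a b where
  continuousOn := by
    have h1 := continuous_lMoment (a := a)
    have h2 := continuous_leftTangent (a := a)
    unfold curveMoment
    fun_prop
  deriv x hx := by
    refine (((hasDerivAt_curveMoment hx.1 (hx.2.le.trans ha)).const_mul (5 / 2)).sub
      (hasDerivAt_lMoment hx.1.ne')).congr_deriv ?_
    ring
  factor_nonneg x hx := by linarith [hx.2]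
  nonneg_of_le x y hx hxy hy hk := by
    refine nonneg_of_unimodal (k := fun b => 5 * (a - leftTangent a b) - lStart a b)
      (k' := fun b => (a - b) * (2 / b - 5 / leftTangent a b)) (m := 8 * a / 29)
      ?_ ?_ ?_ ?_ hx hxy hy hk
    · intro z hz
      have hz0 := hz.1.ne'
      have hT := (leftTangent_pos hz.1 (hz.2.trans ha)).ne'
      refine ((((hasDerivAt_leftTangent hz.1 (hz.2.trans ha)).const_sub a).const_mul 5).sub
        (hasDerivAt_lStart hz0)).congr_deriv ?_
      field_simp
      ring
    · intro z hz hm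
      have hT := leftTangent_pos hz.1 (hz.2.trans ha)
      have hsq := leftTangent_sq hz.1.le (hz.2.trans ha)
      have h5 : 5 * z ≤ 2 * leftTangent a z := by
        refine abs_le_of_sq_le_sq' ?_ (by positivity) |>.2
        nlinarith [hz.1]
      have : 5 / leftTangent a z ≤ 2 / z := by
        rw [div_le_div_iff₀ hT hz.1]
        exact h5
      exact mul_nonneg (by linarith [hz.2]) (by linarith)
    · intro z hz hm
      have hT := leftTangent_pos hz.1 (hz.2.trans ha)
      have hsq := leftTangent_sq hz.1.le (hz.2.trans ha)
      have h5 : 2 * leftTangent a z ≤ 5 * z := by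
        refine abs_le_of_sq_le_sq' ?_ (by linarith [hz.1]) |>.2
        nlinarith [hz.1]
      have : 2 / z ≤ 5 / leftTangent a z := by
        rw [div_le_div_iff₀ hz.1 hT]
        exact h5
      exact mul_nonpos_of_nonneg_of_nonpos (by linarith [hz.2]) (by linarith)
    · -- With `q = √(2 a - 1)` the claim reads `(q - 1) ^ 2 (q + 1) ^ 2 / 20 ≤ (q - 1) ^ 2 / 2`.
      simp only [lStart_one]
      have hq0 := leftTangent_pos one_pos ha
      have hsq := leftTangent_sq zero_le_one ha
      set q := leftTangent a 1
      have hqa : a = (q ^ 2 + 1) / 2 := by linarith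
      have hq2 : q ≤ 2 := by nlinarith
      have h10 : 0 ≤ 10 - (q + 1) ^ 2 := by nlinarith
      have := mul_nonneg (sq_nonneg (q - 1)) h10
      rw [hqa]
      nlinarith

theorem le_line_one (ha : 1 ≤ a) : 0 ≤ 5 / 2 * (a - 1) ^ 4 - lMoment a 1 := by
  rw [lMoment_one]
  nlinarith [pow_nonneg (sub_nonneg.2 ha) 4]

theorem le_line_zero (ha : 2 ≤ a) : 0 ≤ 5 / 2 * (a - 0) ^ 4 - lMoment a 0 := by
  rw [lMoment_zero]
  obtain ⟨c, hc, rfl⟩ : ∃ c, 0 ≤ c ∧ a = c + 2 := ⟨a - 2, by linarith, by ring⟩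
  ring_nf
  positivity

theorem le_curve_zero (ha : 1 ≤ a) (ha2 : a ≤ 2) :
    0 ≤ 5 / 2 * curveMoment a (2 - a) 0 - lMoment a 0 := by
  have h0 : leftTangent a 0 = 0 := by simp [leftTangent]
  rw [lMoment_zero, curveMoment, h0]
  obtain ⟨c, hc, rfl⟩ : ∃ c, 0 ≤ c ∧ a = c + 1 := ⟨a - 1, by linarith, by ring⟩
  have := mul_nonneg (pow_nonneg hc 3) (show 0 ≤ 38 / 3 - c by linarith)
  nlinarith

/-- For `1 ≤ a ≤ 2`, the minimum `b` of the data at which the two points of tangency of the convex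
minorant coincide. From there on the minorant is the chord from `(0, (a - b) ^ 2)` to `(1, 0)`. -/
def chordStart (a : ℝ) : ℝ := a - 2 * √(a - 1)

theorem sq_sub_chordStart (ha : 1 ≤ a) : (a - chordStart a) ^ 2 = 4 * (a - 1) := by
  rw [chordStart, sub_sub_cancel, mul_pow, Real.sq_sqrt (sub_nonneg.2 ha)]
  norm_num

theorem leftTangent_chordStart (ha : 1 ≤ a) (ha2 : a ≤ 2) :
    leftTangent a (chordStart a) = 2 - a := by
  rw [leftTangent, sq_sub_chordStart ha, show a ^ 2 - 4 * (a - 1) = (2 - a) ^ 2 by ring,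
    Real.sqrt_sq (by linarith)]

theorem chordStart_mem (ha : 1 ≤ a) (ha2 : a < 2) : chordStart a ∈ Ioc (0 : ℝ) 1 := by
  have h1 := Real.sqrt_nonneg (a - 1)
  have h2 := Real.sq_sqrt (sub_nonneg.2 ha)
  have h3 : √(a - 1) < 1 := by nlinarith
  refine ⟨?_, ?_⟩ <;> unfold chordStart <;> nlinarith

theorem curve_chordStart (ha : 1 ≤ a) (ha2 : a ≤ 2) :
    curveMoment a (2 - a) (chordStart a) = (a - chordStart a) ^ 4 := by
  rw [curveMoment, leftTangent_chordStart ha ha2,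
    show (a - chordStart a) ^ 4 = ((a - chordStart a) ^ 2) ^ 2 by ring, sq_sub_chordStart ha]
  ring

theorem start_chordStart (ha : 1 ≤ a) (ha2 : a ≤ 2) :
    5 * (a - leftTangent a (chordStart a)) - lStart a (chordStart a) =
      5 / 2 * (a - chordStart a) ^ 2 - lStart a (chordStart a) := by
  rw [leftTangent_chordStart ha ha2, sq_sub_chordStart ha]
  ring

/-- The two regimes agree to first order at `chordStart a`, so their difference from the second
moment of the L estimator changes monotonicity at most once along both. -/
theorem lMoment_le (ha : 1 ≤ a) (hb : 0 ≤ b) (hb1 : b ≤ 1) :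
    (a < 2 → b ≤ chordStart a → lMoment a b ≤ 5 / 2 * curveMoment a (2 - a) b) ∧
    ((2 ≤ a ∨ chordStart a ≤ b) → lMoment a b ≤ 5 / 2 * (a - b) ^ 4) := by
  have hline := isUnimodal_line ha
  have hone := le_line_one ha
  rcases lt_or_ge a 2 with ha2 | ha2
  · have hcurve := isUnimodal_curve (s := 2 - a) ha ha2.le
    have hzero := le_curve_zero ha ha2.le
    have hmem := chordStart_mem ha ha2
    have hD := curve_chordStart ha ha2.le
    have hk := start_chordStart ha ha2.le
    have hend : 0 ≤ 5 / 2 * (a - chordStart a) ^ 4 - lMoment a (chordStart a) := by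
      rcases le_or_gt 0 (5 / 2 * (a - chordStart a) ^ 2 - lStart a (chordStart a)) with h | h
      · exact hone.trans (hline.apply_le_of_nonneg hmem.1 hmem.2 le_rfl h)
      · rw [← hk] at h
        rw [← hD]
        exact hzero.trans (hcurve.le_apply_of_neg le_rfl hmem.1.le hmem.2 h)
    refine ⟨fun _ hbc => sub_nonneg.1 ?_, fun hbc => sub_nonneg.1 ?_⟩
    · rcases hb.eq_or_lt with rfl | hb
      · exact hzero
      rcases le_or_gt 0 (5 * (a - leftTangent a b) - lStart a b) with h | h
      · rw [← hD] at hend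
        exact hend.trans (hcurve.apply_le_of_nonneg hb hbc hmem.2 h)
      · exact hzero.trans (hcurve.le_apply_of_neg le_rfl hb.le hb1 h)
    · have hbc : chordStart a ≤ b := by
        rcases hbc with h | h
        · linarith
        · exact h
      rcases le_or_gt 0 (5 / 2 * (a - b) ^ 2 - lStart a b) with h | h
      · exact hone.trans (hline.apply_le_of_nonneg (hmem.1.trans_le hbc) hb1 le_rfl h)
      · exact hend.trans (hline.le_apply_of_neg hmem.1.le hbc hb1 h)
  · refine ⟨fun h => absurd h (not_lt.2 ha2), fun _ => sub_nonneg.1 ?_⟩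
    have hzero := le_line_zero ha2
    rcases hb.eq_or_lt with rfl | hb
    · exact hzero
    rcases le_or_gt 0 (5 / 2 * (a - b) ^ 2 - lStart a b) with h | h
    · exact hone.trans (hline.apply_le_of_nonneg hb hb1 le_rfl h)
    · exact hzero.trans (hline.le_apply_of_neg le_rfl hb.le hb1 h)

end Comparison

/-! ### The bounds for the squared range -/

section SquaredRangeRatio

variable {a b x : ℝ}

theorem cutSqPrimitive_mul (ha : 0 < a) (x : ℝ) :
    cutSqPrimitive a (2 * a * Real.log a - 2 * a) (a * x) = a ^ 3 * cutSqPrimitive 1 (-2) x := by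
  rcases eq_or_ne x 0 with rfl | hx
  · simp [cutSqPrimitive]
  · simp only [cutSqPrimitive, Real.log_mul ha.ne' hx]
    ring

theorem leftTangent_mul (ha : 0 < a) (x : ℝ) : leftTangent a (a * x) = a * leftTangent 1 x := by
  rw [leftTangent, leftTangent, show a ^ 2 - (a - a * x) ^ 2 = a ^ 2 * (1 ^ 2 - (1 - x) ^ 2) by ring,
    Real.sqrt_mul (sq_nonneg a), Real.sqrt_sq ha.le]

theorem curveMoment_mul (ha : 0 < a) (x : ℝ) :
    curveMoment a a (a * x) = a ^ 3 * curveMoment 1 1 x := by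
  simp only [curveMoment, leftTangent_mul ha]
  ring

theorem le_leftTangent (hb : 0 ≤ b) (hba : b ≤ a) : b ≤ leftTangent a b :=
  Real.le_sqrt_of_sq_le (by nlinarith)

theorem isMinorantCurve_of_le_one (hb : 0 ≤ b) (hba : b ≤ a) (ha1 : a ≤ 1) :
    IsMinorantCurve a b (leftTangent a b) a where
  nonneg := hb
  le_left := le_leftTangent hb hba
  left_le := Real.sqrt_le_iff.2 ⟨hb.trans hba, by nlinarith⟩
  right_le := le_rfl
  le_one := ha1
  sq_left := leftTangent_sq hb hba
  right_eq := Or.inl rfl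

theorem isMinorantCurve_of_one_le (hb : 0 ≤ b) (ha : 1 ≤ a) (ha2 : a < 2)
    (hbc : b ≤ chordStart a) : IsMinorantCurve a b (leftTangent a b) (2 - a) where
  nonneg := hb
  le_left := le_leftTangent hb (hbc.trans ((chordStart_mem ha ha2).2.trans ha))
  left_le := by
    have h1 := sq_sub_chordStart ha
    have h2 := (chordStart_mem ha ha2).2
    refine Real.sqrt_le_iff.2 ⟨by linarith, ?_⟩
    nlinarith
  right_le := by linarith
  le_one := by linarith
  sq_left := leftTangent_sq hb (hbc.trans ((chordStart_mem ha ha2).2.trans ha))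
  right_eq := Or.inr rfl

/-- The chord from `(0, (a - b) ^ 2)` to `(1, 0)` lies below the lower bound function. -/
theorem chord_le (hb : 0 ≤ b) (ha : 1 ≤ a) (hb1 : b ≤ 1) (h : 2 ≤ a ∨ chordStart a ≤ b)
    {x : ℝ} (hx : x ∈ Ioc (0 : ℝ) 1) : (a - b) ^ 2 * (1 - x) ≤ cut a b x ^ 2 := by
  rcases le_total x b with hxb | hxb
  · rw [cut_of_le (hb1.trans ha) hxb]
    nlinarith [sq_nonneg (a - b), hx.1]
  rw [cut_of_mem hxb (hx.2.trans ha)]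
  rcases h with h | h
  · -- `(c + y) ^ 2 / y` decreases for `y ≤ c`, where `c = a - 1` and `y = 1 - x ≤ 1 - b ≤ 1 ≤ c`.
    have h1 : (a - b) ^ 2 * (1 - x) ≤ (a - x) ^ 2 * (1 - b) := by
      have : 0 ≤ (x - b) * ((a - 1) ^ 2 - (1 - x) * (1 - b)) := by
        refine mul_nonneg (by linarith) ?_
        nlinarith [hx.2, hx.1, mul_nonneg (sub_nonneg.2 hx.2) (sub_nonneg.2 hb1)]
      nlinarith
    nlinarith [sq_nonneg (a - x)]
  · have h1 := sq_sub_chordStart ha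
    have h2 : (a - b) ^ 2 ≤ 4 * (a - 1) := by
      rw [← h1]
      exact pow_le_pow_left₀ (by linarith) (by linarith) 2
    nlinarith [sq_nonneg (a - 1 - (1 - x)), mul_le_mul_of_nonneg_right h2 (sub_nonneg.2 hx.2)]

theorem hasLRatioLE_cut_sq (hb : 0 ≤ b) (hba : b ≤ a) :
    HasLRatioLE (fun u => cut a b u ^ 2) (5 / 2) := by
  rcases hba.eq_or_lt with rfl | hba
  · exact hasLRatioLE_of_const le_rfl
      (fun u _ => by rw [cut_self_eq, zero_pow two_ne_zero]) (by norm_num)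
  rcases le_or_gt 1 b with hb1 | hb1
  · exact hasLRatioLE_of_const (sq_nonneg (a - b))
      (fun u hu => by rw [cut_eq_of_one_le hba.le hb1 hu]) (by norm_num)
  obtain ⟨e, he, hbe⟩ := exists_isEnd hba hb1
  obtain ⟨hint, heq⟩ := sq_lPath_cut_sq hb he hbe
  rcases he with ⟨rfl, ha1⟩ | ⟨rfl, ha⟩
  · have h := isMinorantCurve_of_le_one hb hba.le ha1
    refine ⟨_, h.isOptimalPath, hint, ?_⟩
    have he : 0 < e := hb.trans_lt hba
    obtain ⟨x, rfl⟩ : ∃ x, b = e * x := ⟨b / e, by field_simp⟩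
    have hx0 : 0 ≤ x := nonneg_of_mul_nonneg_right hb he
    have hx1 : x ≤ 1 := by nlinarith
    have hunit := (lMoment_le le_rfl hx0 hx1).1 one_lt_two (by simpa [chordStart] using hx1)
    have h1 := cutSqPrimitive_mul he 1
    rw [mul_one] at h1
    have hcurve := curveMoment_mul he x
    rw [curveMoment] at hcurve
    rw [heq, h.integral_sq, hcurve, sub_self, zero_pow two_ne_zero, zero_add, h1,
      cutSqPrimitive_mul he x]
    norm_num [lMoment] at hunit
    nlinarith [mul_le_mul_of_nonneg_left hunit (pow_nonneg he.le 3)]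
  · have hM : ∫ u in (0 : ℝ)..1, lPath (fun u => cut a b u ^ 2) u ^ 2 = lMoment a b := by
      rw [heq, Real.log_one, lMoment]
      ring_nf
    have hle := lMoment_le ha hb hb1.le
    by_cases hcase : 2 ≤ a ∨ chordStart a ≤ b
    · refine ⟨_, isOptimalPath_const (sq_nonneg (a - b)) ?_
        (fun x hx => chord_le hb ha hb1.le hcase hx), hint, ?_⟩
      · rw [cut_zero hb hba.le]
      · rw [hM]
        refine (hle.2 hcase).trans_eq ?_
        simp only [intervalIntegral.integral_const, smul_eq_mul]
        ring
    · push Not at hcase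
      have h := isMinorantCurve_of_one_le hb ha hcase.1 hcase.2.le
      refine ⟨_, h.isOptimalPath, hint, ?_⟩
      rw [hM, h.integral_sq]
      exact hle.1 hcase.1 hcase.2.le

end SquaredRangeRatio

/-! ### The tight ratios -/

section Main

variable {r : ℕ} {τ : ℝ}

theorem lowerPath_eq_cut (hτ : 0 < τ) (p : ℝ) (v : Fin r → ℝ) (u : ℝ) :
    lowerPath τ p v u = (τ * cut ((⨆ i, v i) / τ) ((⨅ i, v i) / τ) u) ^ p := by
  rw [lowerPath, cut, mul_max_of_nonneg _ _ hτ.le, mul_zero, mul_sub, mul_max_of_nonneg _ _ hτ.le,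
    mul_div_cancel₀ _ hτ.ne', mul_div_cancel₀ _ hτ.ne']

theorem lowerPath_one (hτ : 0 < τ) (v : Fin r → ℝ) :
    lowerPath τ 1 v = fun u => τ * cut ((⨆ i, v i) / τ) ((⨅ i, v i) / τ) u := by
  ext u
  rw [lowerPath_eq_cut hτ, Real.rpow_one]

theorem lowerPath_two (hτ : 0 < τ) (v : Fin r → ℝ) :
    lowerPath τ 2 v = fun u => τ ^ 2 * cut ((⨆ i, v i) / τ) ((⨅ i, v i) / τ) u ^ 2 := by
  ext u
  rw [lowerPath_eq_cut hτ, Real.rpow_two, mul_pow]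

theorem iInf_div_nonneg_le [NeZero r] (hτ : 0 < τ) {v : Fin r → ℝ} (hv : 0 ≤ v) :
    0 ≤ (⨅ i, v i) / τ ∧ (⨅ i, v i) / τ ≤ (⨆ i, v i) / τ := by
  refine ⟨div_nonneg (le_ciInf hv) hτ.le, ?_⟩
  have := (iInf_le_apply v 0).trans (apply_le_iSup v 0)
  gcongr

theorem iSup_single [NeZero r] (hτ : 0 < τ) : ⨆ i, (Pi.single 0 τ : Fin r → ℝ) i = τ := by
  refine le_antisymm (ciSup_le fun i => ?_) ?_
  · rcases eq_or_ne i 0 with rfl | hi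
    · simp
    · simpa [hi] using hτ.le
  · simpa using apply_le_iSup (Pi.single 0 τ : Fin r → ℝ) 0

theorem iInf_single [NeZero r] (hr : 2 ≤ r) (hτ : 0 < τ) :
    ⨅ i, (Pi.single 0 τ : Fin r → ℝ) i = 0 := by
  refine le_antisymm ?_ (le_ciInf
    (Pi.single_nonneg.2 hτ.le : (0 : Fin r → ℝ) ≤ Pi.single 0 τ))
  have hne : (⟨1, hr⟩ : Fin r) ≠ 0 := by
    intro h
    simpa using congrArg Fin.val h
  simpa [hne] using iInf_le_apply (Pi.single 0 τ : Fin r → ℝ) ⟨1, hr⟩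

/-- The ratio is attained at `(τ, 0, …, 0)`, where the optimal path is the constant `τ`. -/
theorem lHasTightRatio_one [NeZero r] (hr : 2 ≤ r) (hτ : 0 < τ) :
    LHasTightRatio (fun _ : Fin r => τ) 1 (ENNReal.ofReal 2) := by
  obtain ⟨hint, heq⟩ := sq_lPath_cut (a := 1) le_rfl (Or.inl ⟨rfl, le_rfl⟩) one_pos
  have hsq := integral_sq_step (a := 1) (γ := (1 - 0) / 1) ⟨one_pos, le_rfl⟩
  refine lHasTightRatio_of hτ one_pos zero_le_two (fun v hv => ?_)
    (v₀ := Pi.single 0 τ) (Pi.single_nonneg.2 hτ.le) hτ (B := cut 1 0) ?_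
    (isOptimalPath_cut le_rfl one_pos le_rfl) hint ?_ ?_
  · rw [lowerPath_one hτ]
    obtain ⟨h1, h2⟩ := iInf_div_nonneg_le hτ hv
    exact (hasLRatioLE_cut h1 h2).const_mul hτ
  · rw [lowerPath_one hτ, iSup_single hτ, iInf_single hr hτ, div_self hτ.ne', zero_div]
  · rw [hsq]
    norm_num
  · rw [heq, hsq]
    norm_num

/-- The ratio is attained at `(τ, 0, …, 0)`, where the optimal path is `2 τ ^ 2 (1 - u)`. -/
theorem lHasTightRatio_two [NeZero r] (hr : 2 ≤ r) (hτ : 0 < τ) :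
    LHasTightRatio (fun _ : Fin r => τ) 2 (ENNReal.ofReal (5 / 2)) := by
  obtain ⟨hint, heq⟩ := sq_lPath_cut_sq (a := 1) le_rfl (Or.inl ⟨rfl, le_rfl⟩) one_pos
  have hcurve := isMinorantCurve_of_le_one (a := 1) le_rfl zero_le_one le_rfl
  have hsq := hcurve.integral_sq
  have h0 : leftTangent 1 0 = 0 := by simp [leftTangent]
  refine lHasTightRatio_of hτ two_pos (by norm_num) (fun v hv => ?_)
    (v₀ := Pi.single 0 τ) (Pi.single_nonneg.2 hτ.le) (pow_pos hτ 2)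
    (B := fun u => cut 1 0 u ^ 2) ?_ hcurve.isOptimalPath hint ?_ ?_
  · rw [lowerPath_two hτ]
    obtain ⟨h1, h2⟩ := iInf_div_nonneg_le hτ hv
    exact (hasLRatioLE_cut_sq h1 h2).const_mul (pow_pos hτ 2)
  · rw [lowerPath_two hτ, iSup_single hτ, iInf_single hr hτ, div_self hτ.ne', zero_div]
  · rw [hsq, h0]
    norm_num
  · rw [heq, hsq, h0]
    norm_num [cutSqPrimitive]

end Main

end SharedSeed

end

theorem lemma1 (r : ℕ) (hr : 2 ≤ r) (τ : ℝ) (hτ : 0 < τ) :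
    SharedSeed.LHasTightRatio (fun _ : Fin r => τ) 1 2 ∧
    SharedSeed.LHasTightRatio (fun _ : Fin r => τ) 2 (5 / 2) := by
  have : NeZero r := ⟨by omega⟩
  have h1 := SharedSeed.lHasTightRatio_one hr hτ
  have h2 := SharedSeed.lHasTightRatio_two hr hτ
  rw [ENNReal.ofReal_ofNat] at h1
  rw [ENNReal.ofReal_div_of_pos two_pos, ENNReal.ofReal_ofNat, ENNReal.ofReal_ofNat] at h2
  exact ⟨h1, h2⟩
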